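/- **Setting.** Let $(X_i,Y_i)$, $i\ge 1$, be independent replications of a random vector $(X,Y)\in\mathbb R^d\times\mathbb R$ with $E|Y|<\infty$, defined on a probability space $(\Omega,P)$. Let $\Theta\subset\mathbb R^p$ be compact, $\mathcal G$ a set of real functions (on some set), $\gamma(x,\theta,g)$ a known real function, and $U\subset\mathbb R^k$ compact; let $L(x,u,\theta,g)$ ($u\in U$) be a real weight function. Let $H_0$ be the hypothesis that $E(Y\mid X)=\gamma(X,\theta_0,g_0)$ almost surely for some $\theta_0\in\Theta$, $g_0\in\mathcal G$ (the true values), and $H_A$ its negation. Let $\hat\theta=\hat\theta_n$, $\hat g=\hat g_n$ be estimators, and put $$A_i(u)=L(X_i,u,\hat\theta,\hat g)\,[Y_i-\gamma(X_i,\hat\theta,\hat g)]\ (1\le i\le n),\qquad R_n(u)=n^{-1/2}\sum_{i=1}^n A_i(u),$$ $$EL(u,\hat\theta,\hat g)=\sup\Big\{\prod_{i=1}^n (n w_i): w_i\ge 0,\ \sum_{i=1}^n w_i=1,\ \sum_{i=1}^n w_iA_i(u)=0\Big\}\quad(\sup\emptyset=0),$$ $$\ell(u,\hat\theta,\hat g)=-2\log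 EL(u,\hat\theta,\hat g)\in[0,\infty],\qquad S_n=\sup_{u\in U}\ell(u,\hat\theta,\hat g),\qquad T_n=\int_U\ell(u,\hat\theta,\hat g)\,d\mu_n(u).$$ Here $\mu$ is a finite Borel measure on $U$ and the $\mu_n$ are random finite Borel measures on $U$ with $\sup_{x\in\mathbb R^k}|F_{\mu_n}(x)-F_\mu(x)|=o_P(1)$, where $F_\nu(x)=\nu\{u\in U: u\le x\text{ coordinatewise}\}$. $\ell^\infty(U)$ is the space of bounded real functions on $U$ with the supremum metric. Weak convergence, in $\ell^\infty(U)$ and in $[0,\infty]$, is in the sense of Hoffmann-Jørgensen: the limit is Borel measurable and $E^*f(Z_n)\to Ef(Z)$ for all bounded continuous $f$; for processes in $\ell^\infty(U)$ the paths are required to be finite and bounded only with probability tending to one. Where measurability is not guaranteed, the probabilities in the conditions below (and in $o_P$, $O_P$) are outer probabilities, those in the conclusion of (b) are inner probabilities, and $T_n$ and $\int_U W^2\,d\mu$ are lower integrals. A *box* is a product of $k$ intervals of any kind (possibly degenerate or unbounded). A bounded function $f:U\to\mathbb R$ is called *box-Riemann for $\mu$* if for every $\varepsilon>0$ there is a finite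 cover of $U$ by boxes such that the union of those boxes $B$ with $|f(v)-f(v')|>\varepsilon$ for some $v,v'\in B\cap U$ has $\mu$-measure at most $\varepsilon$. **Theorem 2.1.** (a) Assume $H_0$, with true values $\theta_0,g_0$, and * (C0) $P(EL(u,\hat\theta,\hat g)=0\text{ for some }u\in U)\to0$. * (C1) $\sup_{u\in U}|R_n(u)-n^{-1/2}\sum_{i=1}^nQ(X_i,Y_i,u,\theta_0,g_0)|=o_P(1)$ for some real function $Q$ such that $Q(X,Y,u,\theta_0,g_0)$ is integrable with $E[Q(X,Y,u,\theta_0,g_0)]=0$ for all $u\in U$; and $R_n$ converges weakly in $\ell^\infty(U)$ to a zero-mean Gaussian process $V$. * (C2) $\sup_{u\in U}|n^{-1}\sum_{i=1}^nA_i(u)^2-T(u)|=o_P(1)$ for some function $T$ on $U$ with $\inf_UT>0$ and $\sup_UT<\infty$. * (C3) $\sup_{u\in U}\max_{1\le i\le n}|A_i(u)|=o_P(n^{1/2})$. Then, with $W(u)=V(u)/\sqrt{T(u)}$, the process $\ell(u,\hat\theta,\hat g)$, $u\in U$, converges weakly in $\ell^\infty(U)$ to $W^2$, and hence $$S_n\to_d\sup_{u\in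 U}W^2(u).$$ If moreover almost every path of $W^2$ is box-Riemann for $\mu$ (for instance, if it is continuous at $\mu$-almost every point), then $$T_n\to_d\int_UW^2(u)\,d\mu(u).$$ (b) Assume $H_A$, (C2), and * (C1') $n^{1/2}\big(\inf_{u\in U_0}|R_n(u)|\big)^{-1}=O_P(1)$ for a subset $U_0$ of $U$ of positive $\mu$-measure. * (C3') $\sup_{u\in U}\max_{1\le i\le n}|A_i(u)^2|=o_P(n^{1/2})$. Then $P(S_n>c)\to1$ for every $c>0$. If moreover $U_0$ contains $[a,b]\cap U$ for some closed box $[a,b]$ with $\mu([a,b]\cap U)>0$ (for instance, if $U_0$ contains a relatively open subset of $U$ of positive $\mu$-measure), then also $P(T_n>c)\to1$ for every $c>0$. -/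

import Mathlib

open MeasureTheory ProbabilityTheory Filter Topology
open scoped ENNReal NNReal BoundedContinuousFunction

noncomputable section

/-! ## Outer expectation, weak convergence without measurability, stochastic orders

The statistics below need not be measurable in `ω`, so expectations, probabilities and weak
convergence are taken in the sense of Hoffmann-Jørgensen.  A measure `P` applied to an arbitrary
set is already the outer measure. -/

/-- Outer expectation of a bounded real function `h`. -/
def outerExp {Ω : Type*} [MeasurableSpace Ω] (P : Measure Ω) (h : Ω → ℝ) : ℝ :=
  sInf {r : ℝ | ∃ g : Ω → ℝ, Measurable g ∧ Integrable g P ∧ (∀ ω, h ω ≤ g ω) ∧ r = ∫ ω, g ω ∂P}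

/-- Inner probability of a set; equal to `P s` when `s` is measurable and `P` is a probability. -/
def innerProb {Ω : Type*} [MeasurableSpace Ω] (P : Measure Ω) (s : Set Ω) : ℝ≥0∞ :=
  1 - P sᶜ

/-- Weak convergence `Z n ⇝ Z'` in a topological space `E`: `Z'` is Borel measurable and
`E^* f (Z n) → E f (Z')` for every bounded continuous `f`. -/
def WeakConv {Ω Ω' E : Type*} [MeasurableSpace Ω] [MeasurableSpace Ω'] [TopologicalSpace E]
    (P : Measure Ω) (P' : Measure Ω') (Z : ℕ → Ω → E) (Z' : Ω' → E) : Prop :=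
  @Measurable Ω' E _ (borel E) Z' ∧
    ∀ f : E →ᵇ ℝ,
      Tendsto (fun n => outerExp P (fun ω => f (Z n ω))) atTop (𝓝 (∫ ω', f (Z' ω') ∂P'))

/-- A path that takes finite values and is bounded. -/
def IsBddPath {I : Type*} (z : I → EReal) : Prop :=
  ∃ C : ℝ, ∀ u, ((-C : ℝ) : EReal) ≤ z u ∧ z u ≤ (C : EReal)

lemma IsBddPath.memℓp {I : Type*} {z : I → EReal} (h : IsBddPath z) :
    Memℓp (E := fun _ : I => ℝ) (fun u => (z u).toReal) ∞ := by
  obtain ⟨C, hC⟩ := h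
  refine memℓp_infty ⟨C, ?_⟩
  rintro _ ⟨u, rfl⟩
  obtain ⟨h1, h2⟩ := hC u
  have hb : z u ≠ ⊥ := fun h => by simp [h] at h1
  have ht : z u ≠ ⊤ := fun h => by simp [h] at h2
  change ‖(z u).toReal‖ ≤ C
  rw [Real.norm_eq_abs, abs_le]
  rw [← EReal.coe_toReal ht hb] at h1 h2
  exact ⟨EReal.coe_le_coe_iff.1 h1, EReal.coe_le_coe_iff.1 h2⟩

open Classical in
/-- A finite bounded path as an element of `ℓ^∞(I)` (and `0` for all other paths). -/
def toLinf {I : Type*} (z : I → EReal) : lp (fun _ : I => ℝ) ∞ :=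
  if h : IsBddPath z then ⟨fun u => (z u).toReal, h.memℓp⟩ else 0

/-- Weak convergence in `ℓ^∞(I)` of a sequence of processes whose paths lie in `ℓ^∞(I)` with
(inner) probability tending to one. -/
def WeakConvLinf {Ω Ω' I : Type*} [MeasurableSpace Ω] [MeasurableSpace Ω']
    (P : Measure Ω) (P' : Measure Ω') (Z : ℕ → Ω → I → EReal) (Z' : Ω' → I → ℝ) : Prop :=
  Tendsto (fun n => P {ω | ¬ IsBddPath (Z n ω)}) atTop (𝓝 0) ∧
  (∀ ω', IsBddPath (fun u => (Z' ω' u : EReal))) ∧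
  WeakConv P P' (fun n ω => toLinf (Z n ω)) (fun ω' => toLinf (fun u => (Z' ω' u : EReal)))

/-- `Z n = o_P(1)`, for `[0,∞]`-valued maps. -/
def IsLittleOP {Ω : Type*} [MeasurableSpace Ω] (P : Measure Ω) (Z : ℕ → Ω → ℝ≥0∞) : Prop :=
  ∀ ε : ℝ≥0∞, 0 < ε → Tendsto (fun n => P {ω | ε < Z n ω}) atTop (𝓝 0)

/-- `Z n = O_P(1)`, for `[0,∞]`-valued maps. -/
def IsBigOP {Ω : Type*} [MeasurableSpace Ω] (P : Measure Ω) (Z : ℕ → Ω → ℝ≥0∞) : Prop :=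
  ∀ ε : ℝ≥0∞, 0 < ε → ∃ M : ℝ≥0, ∀ᶠ n in atTop, P {ω | (M : ℝ≥0∞) < Z n ω} ≤ ε

/-! ## Empirical likelihood of a real sample -/

/-- Empirical likelihood ratio for the hypothesis that the values `a 0, …, a (n-1)` have mean
zero; the supremum of the empty set is `0`. -/
def empLik {n : ℕ} (a : Fin n → ℝ) : ℝ :=
  sSup {r : ℝ | ∃ w : Fin n → ℝ, (∀ i, 0 ≤ w i) ∧ ∑ i, w i = 1 ∧ ∑ i, w i * a i = 0 ∧
    r = ∏ i, ((n : ℝ) * w i)}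

/-- `-2 log EL`, with value `∞` when `EL = 0` (recall `0 ≤ EL ≤ 1`). -/
def negTwoLogEL {n : ℕ} (a : Fin n → ℝ) : ℝ≥0∞ :=
  if empLik a = 0 then ∞ else ENNReal.ofReal (-2 * Real.log (empLik a))

/-! ## Measures on the index set -/

/-- The trace on `U` of the box `B 0 × … × B (k-1)`. -/
def boxTrace {k : ℕ} (U : Set (Fin k → ℝ)) (B : Fin k → Set ℝ) : Set U :=
  {u | ∀ i, (u : Fin k → ℝ) i ∈ B i}

/-- Distribution function of a measure on `U ⊆ ℝ^k`. -/
def distFun {k : ℕ} {U : Set (Fin k → ℝ)} (ν : Measure U) (x : Fin k → ℝ) : ℝ :=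
  ν.real {v : U | (v : Fin k → ℝ) ≤ x}

/-- Riemann integrability of `f` with respect to `ν` through finite covers of `U` by boxes (products
of intervals of any kind): for every `ε > 0` there is such a cover for which the union of the boxes
on which `f` oscillates by more than `ε` has measure at most `ε`. -/
def IsBoxRiemann {k : ℕ} {U : Set (Fin k → ℝ)} (ν : Measure U) (f : U → ℝ) : Prop :=
  ∀ ε : ℝ, 0 < ε → ∃ (N : ℕ) (B : Fin N → Fin k → Set ℝ),
    (∀ j i, (B j i).OrdConnected) ∧
    (∀ u : U, ∃ j, u ∈ boxTrace U (B j)) ∧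
    ν {u : U | ∃ j, u ∈ boxTrace U (B j) ∧
        ∃ v ∈ boxTrace U (B j), ∃ v' ∈ boxTrace U (B j), ε < |f v - f v'|} ≤ ENNReal.ofReal ε

/-! ## The testing problem -/

/-- The objects of the testing problem: observations `(X i, Y i)`, `i = 0, 1, …`, with
`X i ∈ ℝ^d`; the model function `γ (x, θ, g)` and the weight function `L (x, u, θ, g)`, where `g` is
a real function on a set `S`; the estimators of `θ` and `g`, where index `n` is the sample size. -/
structure TestSetup (Ω S : Type*) (d p : ℕ) {k : ℕ} (U : Set (Fin k → ℝ)) where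
  X : ℕ → Ω → (Fin d → ℝ)
  Y : ℕ → Ω → ℝ
  γ : (Fin d → ℝ) → (Fin p → ℝ) → (S → ℝ) → ℝ
  L : (Fin d → ℝ) → U → (Fin p → ℝ) → (S → ℝ) → ℝ
  thetaHat : ℕ → Ω → (Fin p → ℝ)
  gHat : ℕ → Ω → (S → ℝ)

namespace TestSetup

variable {Ω S : Type*} {d p k : ℕ} {U : Set (Fin k → ℝ)} (D : TestSetup Ω S d p U)

/-- `(X i, Y i)` are independent replications of a random vector whose second coordinate is
integrable (so that the regression function exists). -/
structure IsSample [MeasurableSpace Ω] (P : Measure Ω) : Prop where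
  measurable_X : ∀ i, Measurable (D.X i)
  measurable_Y : ∀ i, Measurable (D.Y i)
  indep : iIndepFun (fun i ω => (D.X i ω, D.Y i ω)) P
  identDistrib : ∀ i, IdentDistrib (fun ω => (D.X i ω, D.Y i ω)) (fun ω => (D.X 0 ω, D.Y 0 ω)) P P
  integrable_Y : Integrable (D.Y 0) P

/-- `θ ∈ Θ` and `g ∈ G` are true values: `E(Y | X) = γ (X, θ, g)` almost surely. -/
def IsTrue [MeasurableSpace Ω] (P : Measure Ω) (Θ : Set (Fin p → ℝ)) (G : Set (S → ℝ))
    (θ : Fin p → ℝ) (g : S → ℝ) : Prop :=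
  θ ∈ Θ ∧ g ∈ G ∧
    P[D.Y 0 | MeasurableSpace.comap (D.X 0) inferInstance] =ᵐ[P] fun ω => D.γ (D.X 0 ω) θ g

/-- The null hypothesis that the regression function is one of the functions `γ (·, θ, g)`. -/
def H0 [MeasurableSpace Ω] (P : Measure Ω) (Θ : Set (Fin p → ℝ)) (G : Set (S → ℝ)) : Prop :=
  ∃ θ g, D.IsTrue P Θ G θ g

/-- `L (X_i, u, θ̂, ĝ) (Y_i - γ (X_i, θ̂, ĝ))` for sample size `n`. -/
def A (n : ℕ) (ω : Ω) (u : U) (i : Fin n) : ℝ :=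
  D.L (D.X i ω) u (D.thetaHat n ω) (D.gHat n ω) *
    (D.Y i ω - D.γ (D.X i ω) (D.thetaHat n ω) (D.gHat n ω))

/-- The marked empirical process. -/
def R (n : ℕ) (ω : Ω) (u : U) : ℝ :=
  (√(n : ℝ))⁻¹ * ∑ i, D.A n ω u i

def EL (n : ℕ) (ω : Ω) (u : U) : ℝ := empLik (D.A n ω u)

def ell (n : ℕ) (ω : Ω) (u : U) : ℝ≥0∞ := negTwoLogEL (D.A n ω u)

def supStat (n : ℕ) (ω : Ω) : ℝ≥0∞ := ⨆ u, D.ell n ω u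

def intStat (μn : ℕ → Ω → Measure U) (n : ℕ) (ω : Ω) : ℝ≥0∞ := ∫⁻ u, D.ell n ω u ∂(μn n ω)

variable [MeasurableSpace Ω] (P : Measure Ω)

def C0 : Prop := Tendsto (fun n => P {ω | ∃ u, D.EL n ω u = 0}) atTop (𝓝 0)

/-- Asymptotic representation of `R n`, and weak convergence to a centred Gaussian process `V`. -/
structure C1 {Ω' : Type*} [MeasurableSpace Ω'] (P' : Measure Ω')
    (Q : (Fin d → ℝ) → ℝ → U → (Fin p → ℝ) → (S → ℝ) → ℝ) (θ₀ : Fin p → ℝ) (g₀ : S → ℝ)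
    (V : Ω' → U → ℝ) : Prop where
  expansion : IsLittleOP P (fun n ω =>
    ⨆ u : U, ‖D.R n ω u - (√(n : ℝ))⁻¹ * ∑ i : Fin n, Q (D.X i ω) (D.Y i ω) u θ₀ g₀‖ₑ)
  integrable : ∀ u, Integrable (fun ω => Q (D.X 0 ω) (D.Y 0 ω) u θ₀ g₀) P
  centred : ∀ u, ∫ ω, Q (D.X 0 ω) (D.Y 0 ω) u θ₀ g₀ ∂P = 0
  gaussian : IsGaussianProcess (fun u ω' => V ω' u) P'
  mean_zero : ∀ u, ∫ ω', V ω' u ∂P' = 0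
  weakConv : WeakConvLinf P P' (fun n ω u => (D.R n ω u : EReal)) V

/-- Uniform convergence of the second moments to a function `T` bounded away from `0` and `∞`. -/
structure C2 (T : U → ℝ) : Prop where
  conv : IsLittleOP P (fun n ω => ⨆ u : U, ‖(n : ℝ)⁻¹ * ∑ i, (D.A n ω u i) ^ 2 - T u‖ₑ)
  lower : ∃ c : ℝ, 0 < c ∧ ∀ u, c ≤ T u
  upper : ∃ C : ℝ, ∀ u, T u ≤ C

def C3 : Prop :=
  IsLittleOP P (fun n ω => (⨆ u : U, ⨆ i, ‖D.A n ω u i‖ₑ) / ENNReal.ofReal √(n : ℝ))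

def C1' (U₀ : Set U) : Prop :=
  IsBigOP P (fun n ω => ENNReal.ofReal √(n : ℝ) * (⨅ u ∈ U₀, ‖D.R n ω u‖ₑ)⁻¹)

def C3' : Prop :=
  IsLittleOP P (fun n ω => (⨆ u : U, ⨆ i, ‖(D.A n ω u i) ^ 2‖ₑ) / ENNReal.ofReal √(n : ℝ))

end TestSetup

end

/-!
The proof has three ingredients.

*Empirical likelihood.*  The Lagrange multiplier of the constrained maximization is never needed.
For any `t` with `1 + t aᵢ > 0`, the inequality `∏ yᵢ ≤ exp (∑ (yᵢ - 1))` with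
`yᵢ = n wᵢ (1 + t aᵢ)` bounds every feasible product by `exp (-∑ log (1 + t aᵢ))`
(`ofReal_le_negTwoLogEL`).  Conversely, the explicit weights `(1 - m (aᵢ - m) / D) / n`, where `m`
is the mean and `D` the variance of the sample, are feasible and positive as soon as `m * max |aᵢ|`
is small compared with `D`.  Taking `t = m / S` with `S` the second moment, the two bounds agree to
leading order, which gives the Wilks expansion `-2 log EL ≈ n m² / S` with an explicit error
(`exists_negTwoLogEL_approx`), hence uniformly over the index set.  For a mean bounded away from
zero, `t = ± 1 / (2 n ^ (1/4))` makes `-2 log EL` diverge (`ofReal_le_negTwoLogEL_of_mean`).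

*Weak convergence.*  Weak convergence in the sense of Hoffmann-Jørgensen is equivalent to the
portmanteau inequality for closed sets, with no separability of the limit
(`WeakConv.eventually_measure_closed_le`, `WeakConv.of_eventually_measure_closed_le`).  This yields
Slutsky's lemma `WeakConv.of_dist`.  As `z ↦ z² / T` is continuous on `ℓ^∞(U)`, so that
`R² / T` converges weakly to `V² / T`, the Wilks expansion gives the limit of the log likelihood
ratio process, and the continuous supremum functional gives that of the supremum statistic.

*The integral statistic.*  Closeness of distribution functions bounds the difference of the two
measures on every box (each interval is a difference of two lower sets) and, by
inclusion-exclusion, on the atoms of the partition generated by `N` boxes, with a constant depending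
on `N` only.  So the lower integrals of a function with a good cover by at most `N` boxes are close
(`lintegral_le_of_hasBoxCover`).  Functions that are uniformly near one with such a cover form an
open set, increasing with `N`, and the limit process belongs to their union almost surely;
the portmanteau inequality then gives a good cover of `R² / T` by a bounded number of boxes, up to
small probability (`WeakConv.exists_eventually_hasBoxCover`).
-/

/-! ### Outer expectation and weak convergence without measurability -/

section OuterExpectation

variable {Ω : Type*} [MeasurableSpace Ω] {P : Measure Ω}

/-- The lower bound `c` keeps the defining infimum from being that of an unbounded set. -/
lemma outerExp_le {h g : Ω → ℝ} {c : ℝ} (hc : ∀ ω, c ≤ h ω) [IsProbabilityMeasure P]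
    (hg : Measurable g) (hgi : Integrable g P) (hhg : ∀ ω, h ω ≤ g ω) :
    outerExp P h ≤ ∫ ω, g ω ∂P := by
  refine csInf_le ⟨c, ?_⟩ ⟨g, hg, hgi, hhg, rfl⟩
  rintro _ ⟨g', -, hi, hle, rfl⟩
  simpa using integral_mono (integrable_const c) hi fun ω => (hc ω).trans (hle ω)

/-- The upper bound `C` makes the set of majorants nonempty. -/
lemma le_outerExp {h : Ω → ℝ} {C c : ℝ} [IsProbabilityMeasure P] (hC : ∀ ω, h ω ≤ C)
    (H : ∀ g : Ω → ℝ, Measurable g → Integrable g P → (∀ ω, h ω ≤ g ω) → c ≤ ∫ ω, g ω ∂P) :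
    c ≤ outerExp P h := by
  refine le_csInf ⟨_, fun _ => C, measurable_const, integrable_const C, hC, rfl⟩ ?_
  rintro _ ⟨g, hg, hgi, hle, rfl⟩
  exact H g hg hgi hle

/-- The inner expectation `-E^*(-h)` is at most the outer expectation. -/
lemma neg_outerExp_neg_le {h : Ω → ℝ} {C : ℝ} [IsProbabilityMeasure P] (hC : ∀ ω, |h ω| ≤ C) :
    -outerExp P (fun ω => -h ω) ≤ outerExp P h := by
  refine le_outerExp (C := C) (fun ω => (abs_le.1 (hC ω)).2) fun g hg hgi hle => ?_
  rw [neg_le]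
  refine le_outerExp (C := C) (fun ω => neg_le.1 (abs_le.1 (hC ω)).1) fun g' hg' hgi' hle' => ?_
  have h0 : (0 : ℝ) ≤ ∫ ω, (g ω + g' ω) ∂P :=
    integral_nonneg fun ω => by
      have := hle ω
      have := hle' ω
      show (0 : ℝ) ≤ g ω + g' ω
      linarith
  rw [integral_add hgi hgi'] at h0
  linarith

/-- Markov's inequality for the outer expectation. -/
lemma measure_le_ofReal_outerExp {h : Ω → ℝ} {C : ℝ} [IsProbabilityMeasure P] {s : Set Ω}
    (h0 : ∀ ω, 0 ≤ h ω) (hC : ∀ ω, h ω ≤ C) (hs : ∀ ω ∈ s, 1 ≤ h ω) :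
    P s ≤ ENNReal.ofReal (outerExp P h) := by
  rw [← ENNReal.ofReal_toReal (measure_ne_top P s)]
  refine ENNReal.ofReal_le_ofReal (le_outerExp hC fun g hg hgi hle => ?_)
  have hm := mul_meas_ge_le_integral_of_nonneg (μ := P) (f := g)
    (Eventually.of_forall fun ω => (h0 ω).trans (hle ω)) hgi 1
  rw [one_mul] at hm
  exact (measureReal_mono (μ := P) fun ω hω => (hs ω hω).trans (hle ω)).trans hm

/-- Layer-cake bound: a finite sum of level sets dominates the outer expectation. -/
lemma outerExp_le_sum_levels {h : Ω → ℝ} [IsProbabilityMeasure P] {C : ℝ} (hC0 : 0 < C)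
    (hC : ∀ ω, |h ω| ≤ C) {m : ℕ} (hm : 0 < m) :
    outerExp P h ≤ -C + ∑ i ∈ Finset.range m,
      2 * C / m * P.real {ω | -C + i * (2 * C / m) ≤ h ω} := by
  set δ : ℝ := 2 * C / m with hδ
  have hm' : (0 : ℝ) < m := by exact_mod_cast hm
  have hδ0 : 0 < δ := by positivity
  -- measurable hulls of the level sets have the same outer measure
  set A : ℕ → Set Ω := fun i => toMeasurable P {ω | -C + i * δ ≤ h ω} with hA
  have hAm : ∀ i, MeasurableSet (A i) := fun i => measurableSet_toMeasurable _ _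
  have hint : ∀ i, Integrable ((A i).indicator fun _ => δ) P := fun i =>
    (integrable_const δ).indicator (hAm i)
  set g : Ω → ℝ := fun ω => -C + ∑ i ∈ Finset.range m, (A i).indicator (fun _ => δ) ω with hg
  have hle : ∀ ω, h ω ≤ g ω := by
    intro ω
    -- the partial sums stay above `min (j δ) (h ω + C)`
    have key : ∀ j : ℕ, min (j * δ) (h ω + C) ≤
        ∑ i ∈ Finset.range j, (A i).indicator (fun _ => δ) ω := by
      intro j
      induction j with
      | zero => simp
      | succ j ih =>
        rw [Finset.sum_range_succ]
        push_cast
        by_cases hj : -C + j * δ ≤ h ω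
        · have hmem : ω ∈ A j := subset_toMeasurable _ _ hj
          rw [Set.indicator_of_mem hmem]
          rw [min_eq_left (by linarith)] at ih
          exact (min_le_left _ _).trans (by linarith)
        · rw [min_eq_right (by linarith)] at ih
          have : 0 ≤ (A j).indicator (fun _ => δ) ω := Set.indicator_nonneg (fun _ _ => hδ0.le) _
          exact (min_le_right _ _).trans (by linarith)
    have h1 := key m
    have h2 : (m : ℝ) * δ = 2 * C := by rw [hδ]; field_simp
    have h3 := (abs_le.1 (hC ω)).2
    rw [min_eq_right (by linarith)] at h1
    simp only [hg]
    linarith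
  have hgm : Measurable g := measurable_const.add
    (Finset.measurable_sum _ fun i _ => measurable_const.indicator (hAm i))
  have hsi : Integrable (fun ω => ∑ i ∈ Finset.range m, (A i).indicator (fun _ => δ) ω) P :=
    integrable_finsetSum _ fun i _ => hint i
  have := outerExp_le (P := P) (fun ω => (abs_le.1 (hC ω)).1) hgm
    ((integrable_const _).add hsi) hle
  refine this.trans (le_of_eq ?_)
  simp only [hg]
  rw [integral_add (integrable_const _) hsi, integral_finsetSum _ fun i _ => hint i]
  simp only [integral_const, probReal_univ, one_smul]
  congr 1
  refine Finset.sum_congr rfl fun i _ => ?_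
  rw [integral_indicator (hAm i), setIntegral_const, smul_eq_mul, mul_comm]
  congr 1
  exact congrArg ENNReal.toReal (measure_toMeasurable _)

end OuterExpectation

section WeakConvergence

variable {Ω Ω' : Type*} [MeasurableSpace Ω] [MeasurableSpace Ω'] {P : Measure Ω}
  {P' : Measure Ω'}

/-- Continuous mapping theorem. -/
lemma WeakConv.comp {E F : Type*} [TopologicalSpace E] [TopologicalSpace F]
    {Z : ℕ → Ω → E} {Z' : Ω' → E} (h : WeakConv P P' Z Z') {φ : E → F} (hφ : Continuous φ) :
    WeakConv P P' (fun n ω => φ (Z n ω)) (fun ω' => φ (Z' ω')) := by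
  let : MeasurableSpace E := borel E
  have : BorelSpace E := ⟨rfl⟩
  let : MeasurableSpace F := borel F
  have : BorelSpace F := ⟨rfl⟩
  exact ⟨hφ.measurable.comp h.1, fun f => h.2 (f.compContinuous ⟨φ, hφ⟩)⟩

variable [IsProbabilityMeasure P]

/-- Changing a bounded function on a set of small outer probability changes the outer expectation
little. -/
lemma outerExp_le_add_measure {f g : Ω → ℝ} {C : ℝ} (hf : ∀ ω, |f ω| ≤ C) (hg : ∀ ω, |g ω| ≤ C) :
    outerExp P f ≤ outerExp P g + 2 * C * P.real {ω | f ω ≠ g ω} := by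
  set A := toMeasurable P {ω | f ω ≠ g ω}
  have hA : MeasurableSet A := measurableSet_toMeasurable _ _
  have hC0 : 0 ≤ C := by
    obtain ⟨ω⟩ : Nonempty Ω := nonempty_of_isProbabilityMeasure P
    exact (abs_nonneg _).trans (hf ω)
  rw [← sub_le_iff_le_add]
  refine le_outerExp (C := C) (fun ω => (abs_le.1 (hg ω)).2) fun φ hφ hφi hle => ?_
  rw [sub_le_iff_le_add]
  have hint : Integrable (A.indicator fun _ => 2 * C) P := (integrable_const _).indicator hA
  refine (outerExp_le (P := P) (g := fun ω => φ ω + A.indicator (fun _ => 2 * C) ω)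
    (fun ω => (abs_le.1 (hf ω)).1) (hφ.add (measurable_const.indicator hA)) (hφi.add hint)
    fun ω => ?_).trans (le_of_eq ?_)
  · by_cases hω : f ω = g ω
    · rw [hω]
      have : 0 ≤ A.indicator (fun _ => 2 * C) ω := Set.indicator_nonneg (fun _ _ => by positivity) _
      linarith [hle ω]
    · rw [Set.indicator_of_mem (subset_toMeasurable P _ hω)]
      linarith [hle ω, (abs_le.1 (hf ω)).2, (abs_le.1 (hg ω)).1]
  · rw [integral_add hφi hint, integral_indicator hA, setIntegral_const, smul_eq_mul, mul_comm]
    congr 2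
    exact congrArg ENNReal.toReal (measure_toMeasurable _)

/-- Sequences that agree with probability tending to one have the same weak limits. -/
lemma WeakConv.congr {E : Type*} [TopologicalSpace E] {Y Z : ℕ → Ω → E} {Z' : Ω' → E}
    (h : WeakConv P P' Z Z') (hd : Tendsto (fun n => P {ω | Y n ω ≠ Z n ω}) atTop (𝓝 0)) :
    WeakConv P P' Y Z' := by
  refine ⟨h.1, fun f => ?_⟩
  have hr : Tendsto (fun n => 2 * ‖f‖ * P.real {ω | Y n ω ≠ Z n ω}) atTop (𝓝 0) := by
    have := (ENNReal.tendsto_toReal ENNReal.zero_ne_top).comp hd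
    simpa [Measure.real] using this.const_mul (2 * ‖f‖)
  have hup := (h.2 f).add hr
  have hlo := (h.2 f).sub hr
  rw [add_zero] at hup
  rw [sub_zero] at hlo
  have hb : ∀ Z : ℕ → Ω → E, ∀ n ω, |f (Z n ω)| ≤ ‖f‖ := fun Z n ω => f.norm_coe_le_norm _
  refine tendsto_of_tendsto_of_tendsto_of_le_of_le hlo hup (fun n => ?_) fun n => ?_
  · have := outerExp_le_add_measure (P := P) (hb Z n) (hb Y n)
    have h2 : P.real {ω | f (Z n ω) ≠ f (Y n ω)} ≤ P.real {ω | Y n ω ≠ Z n ω} :=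
      measureReal_mono fun ω hω h' => hω (by rw [h'])
    have := mul_le_mul_of_nonneg_left h2 (show 0 ≤ 2 * ‖f‖ by positivity)
    simp only
    linarith
  · have := outerExp_le_add_measure (P := P) (hb Y n) (hb Z n)
    have h2 : P.real {ω | f (Y n ω) ≠ f (Z n ω)} ≤ P.real {ω | Y n ω ≠ Z n ω} :=
      measureReal_mono fun ω hω h' => hω (by rw [h'])
    have := mul_le_mul_of_nonneg_left h2 (show 0 ≤ 2 * ‖f‖ by positivity)
    simp only
    linarith

variable [IsProbabilityMeasure P']

/-- Portmanteau theorem, closed sets: no separability of the limit is needed. -/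
lemma WeakConv.eventually_measure_closed_le {E : Type*} [PseudoMetricSpace E]
    {Z : ℕ → Ω → E} {Z' : Ω' → E} (h : WeakConv P P' Z Z') {F : Set E} (hF : IsClosed F)
    {η : ℝ≥0∞} (hη : 0 < η) :
    ∀ᶠ n in atTop, P {ω | Z n ω ∈ F} ≤ P' (Z' ⁻¹' F) + η := by
  let : MeasurableSpace E := borel E
  have : BorelSpace E := ⟨rfl⟩
  obtain ⟨hm, hconv⟩ := h
  have : IsProbabilityMeasure (P'.map Z') := Measure.isProbabilityMeasure_map hm.aemeasurable
  obtain ⟨δ, -, hδ0, hδ⟩ := exists_seq_strictAnti_tendsto (0 : ℝ)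
  have hlim := tendsto_lintegral_thickenedIndicator_of_isClosed (P'.map Z') hF hδ0 hδ
  rw [Measure.map_apply hm hF.measurableSet] at hlim
  rcases eq_or_ne η ∞ with rfl | hηt
  · simp
  have hη2 : η / 2 ≠ 0 := (ENNReal.half_pos hη.ne').ne'
  obtain ⟨m, hmle⟩ := (hlim.eventually_le_const
    (ENNReal.lt_add_right (measure_ne_top P' _) hη2)).exists
  set t : E →ᵇ ℝ≥0 := thickenedIndicator (hδ0 m) F with ht
  have ht1 : ∀ x, (t x : ℝ) ≤ 1 := fun x => by exact_mod_cast thickenedIndicator_le_one (hδ0 m) F x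
  let f : E →ᵇ ℝ := BoundedContinuousFunction.ofNormedAddCommGroup (fun x => (t x : ℝ))
    (NNReal.continuous_coe.comp t.continuous) 1 (fun x => by
      rw [Real.norm_eq_abs, abs_of_nonneg (t x).coe_nonneg]; exact ht1 x)
  have hfe : ENNReal.ofReal (∫ ω', f (Z' ω') ∂P') ≤ P' (Z' ⁻¹' F) + η / 2 := by
    refine le_trans (le_of_eq ?_) hmle
    have hfm : Measurable fun ω' => f (Z' ω') := f.continuous.measurable.comp hm
    rw [lintegral_map (by fun_prop) hm, ofReal_integral_eq_lintegral_ofReal]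
    · refine lintegral_congr fun ω' => ?_
      show ENNReal.ofReal (t (Z' ω') : ℝ) = _
      rw [ENNReal.ofReal_coe_nnreal]
    · refine Integrable.of_bound hfm.aestronglyMeasurable 1 (Eventually.of_forall fun ω' => ?_)
      show ‖(t (Z' ω') : ℝ)‖ ≤ 1
      rw [Real.norm_eq_abs, abs_of_nonneg (t _).coe_nonneg]; exact ht1 _
    · exact Eventually.of_forall fun ω' => (t (Z' ω')).coe_nonneg
  have hev := (ENNReal.tendsto_ofReal (hconv f)).eventually_lt_const
    (lt_of_le_of_lt hfe (ENNReal.add_lt_add_left (measure_ne_top P' _)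
      (ENNReal.half_lt_self hη.ne' hηt)))
  filter_upwards [hev] with n hn
  refine le_trans ?_ hn.le
  refine measure_le_ofReal_outerExp (C := 1) (fun ω => (t _).coe_nonneg) (fun ω => ht1 _) ?_
  intro ω hω
  show (1 : ℝ) ≤ (t (Z n ω) : ℝ)
  rw [ht, thickenedIndicator_one (hδ0 m) F hω]
  simp

/-- Converse of the portmanteau theorem: the estimates on closed sets imply weak convergence. -/
lemma WeakConv.of_eventually_measure_closed_le {E : Type*} [TopologicalSpace E]
    {Z : ℕ → Ω → E} {Z' : Ω' → E} (hm : @Measurable Ω' E _ (borel E) Z')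
    (H : ∀ F : Set E, IsClosed F → ∀ η : ℝ≥0∞, 0 < η →
      ∀ᶠ n in atTop, P {ω | Z n ω ∈ F} ≤ P' (Z' ⁻¹' F) + η) :
    WeakConv P P' Z Z' := by
  let : MeasurableSpace E := borel E
  have : BorelSpace E := ⟨rfl⟩
  refine ⟨hm, ?_⟩
  have hint : ∀ f : E →ᵇ ℝ, Integrable (fun ω' => f (Z' ω')) P' := fun f =>
    Integrable.of_bound (f.continuous.measurable.comp hm).aestronglyMeasurable ‖f‖
      (Eventually.of_forall fun ω' => f.norm_coe_le_norm _)
  -- it suffices to bound the upper limit, and to apply this to `f` and to `-f`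
  have upper : ∀ f : E →ᵇ ℝ, ∀ ε : ℝ, 0 < ε → ∀ᶠ n in atTop,
      outerExp P (fun ω => f (Z n ω)) ≤ ∫ ω', f (Z' ω') ∂P' + ε := by
    intro f ε hε
    -- `m` levels at distance `δ ≤ ε / 2`, each with an error `η` in probability, where
    -- `m * δ * η = ε / 2`
    set C : ℝ := ‖f‖ + 1 with hC
    have hC0 : 0 < C := by positivity
    have hfC : ∀ x, |f x| ≤ C := fun x => (f.norm_coe_le_norm x).trans (by simp [hC])
    obtain ⟨m, hmgt⟩ := exists_nat_gt (4 * C / ε)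
    have hm0' : (0 : ℝ) < m := lt_trans (by positivity) hmgt
    have hm0 : 0 < m := by exact_mod_cast hm0'
    set δ : ℝ := 2 * C / m with hδ
    have hδ0 : 0 < δ := by positivity
    have hδε : δ ≤ ε / 2 := by
      rw [hδ, div_le_div_iff₀ hm0' (by norm_num)]
      rw [div_lt_iff₀ hε] at hmgt
      nlinarith
    set η : ℝ := ε / (4 * C) with hη
    have hη0 : 0 < η := by positivity
    have hcl : ∀ i : ℕ, IsClosed {x : E | -C + i * δ ≤ f x} := fun i =>
      isClosed_le continuous_const f.continuous
    have hev : ∀ᶠ n in atTop, ∀ i ∈ Finset.range m,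
        P {ω | Z n ω ∈ {x : E | -C + i * δ ≤ f x}} ≤
          P' (Z' ⁻¹' {x : E | -C + i * δ ≤ f x}) + ENNReal.ofReal η :=
      (Finset.eventually_all _).2 fun i _ => H _ (hcl i) _ (ENNReal.ofReal_pos.2 hη0)
    filter_upwards [hev] with n hn
    refine (outerExp_le_sum_levels hC0 (fun ω => hfC (Z n ω)) hm0).trans ?_
    have hreal : ∀ i ∈ Finset.range m, P.real {ω | -C + i * δ ≤ f (Z n ω)} ≤
        P'.real (Z' ⁻¹' {x : E | -C + i * δ ≤ f x}) + η := by
      intro i hi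
      have h1 := ENNReal.toReal_mono (by finiteness) (hn i hi)
      rwa [ENNReal.toReal_add (by finiteness) (by finiteness), ENNReal.toReal_ofReal hη0.le] at h1
    have hms : ∀ i : ℕ, MeasurableSet (Z' ⁻¹' {x : E | -C + i * δ ≤ f x}) := fun i =>
      hm (hcl i).measurableSet
    have hsum : ∑ i ∈ Finset.range m, δ * P'.real (Z' ⁻¹' {x : E | -C + i * δ ≤ f x}) ≤
        ∫ ω', f (Z' ω') ∂P' + C + δ := by
      have e1 : ∀ i ∈ Finset.range m, δ * P'.real (Z' ⁻¹' {x : E | -C + i * δ ≤ f x}) =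
          ∫ ω', (Z' ⁻¹' {x : E | -C + i * δ ≤ f x}).indicator (fun _ => δ) ω' ∂P' := by
        intro i _
        rw [integral_indicator (hms i), setIntegral_const, smul_eq_mul, mul_comm]
      rw [Finset.sum_congr rfl e1, ← integral_finsetSum _ fun i _ =>
        (integrable_const δ).indicator (hms i)]
      have e2 : ∫ ω', f (Z' ω') ∂P' + C + δ = ∫ ω', (f (Z' ω') + (C + δ)) ∂P' := by
        rw [integral_add (hint f) (integrable_const _)]; simp; ring
      rw [e2]
      refine integral_mono (integrable_finsetSum _ fun i _ =>
        (integrable_const δ).indicator (hms i)) ((hint f).add (integrable_const _)) fun ω' => ?_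
      have h0 := (abs_le.1 (hfC (Z' ω'))).1
      have key : ∀ j : ℕ, ∑ i ∈ Finset.range j,
          (Z' ⁻¹' {x : E | -C + i * δ ≤ f x}).indicator (fun _ => δ) ω' ≤
            min (j * δ) (f (Z' ω') + (C + δ)) := by
        intro j
        induction j with
        | zero =>
          simp only [Finset.range_zero, Finset.sum_empty]
          exact le_min (by simp) (by linarith)
        | succ j ih =>
          rw [Finset.sum_range_succ]
          push_cast
          have ih1 := ih.trans (min_le_left _ _)
          have ih2 := ih.trans (min_le_right _ _)
          by_cases hj : -C + j * δ ≤ f (Z' ω')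
          · rw [Set.indicator_of_mem (by exact hj)]
            exact le_min (by linarith) (by linarith)
          · rw [Set.indicator_of_notMem (by exact hj)]
            exact le_min (by linarith) (by linarith)
      exact (key m).trans (min_le_right _ _)
    have hfin : ∑ i ∈ Finset.range m, δ * P.real {ω | -C + i * δ ≤ f (Z n ω)} ≤
        ∑ i ∈ Finset.range m, δ * P'.real (Z' ⁻¹' {x : E | -C + i * δ ≤ f x}) + m * (δ * η) := by
      calc _ ≤ ∑ i ∈ Finset.range m,
            (δ * P'.real (Z' ⁻¹' {x : E | -C + i * δ ≤ f x}) + δ * η) :=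
            Finset.sum_le_sum fun i hi => by nlinarith [hreal i hi]
        _ = _ := by rw [Finset.sum_add_distrib]; simp
    have hmδ : (m : ℝ) * (δ * η) = ε / 2 := by rw [hδ, hη]; field_simp; norm_num
    linarith
  intro f
  rw [Metric.tendsto_nhds]
  intro ε hε
  filter_upwards [upper f (ε / 2) (by linarith), upper (-f) (ε / 2) (by linarith)] with n h1 h2
  have h3 := neg_outerExp_neg_le (P := P) (h := fun ω => f (Z n ω)) (C := ‖f‖)
    fun ω => f.norm_coe_le_norm _
  simp only [BoundedContinuousFunction.coe_neg, Pi.neg_apply, integral_neg] at h2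
  rw [Real.dist_eq, abs_lt]
  constructor <;> linarith

/-- Slutsky's lemma: a perturbation that vanishes in outer probability keeps the weak limit. -/
lemma WeakConv.of_dist {E : Type*} [PseudoMetricSpace E] {Y Z : ℕ → Ω → E} {Z' : Ω' → E}
    (h : WeakConv P P' Z Z')
    (hd : ∀ ε : ℝ, 0 < ε → Tendsto (fun n => P {ω | ε < dist (Y n ω) (Z n ω)}) atTop (𝓝 0)) :
    WeakConv P P' Y Z' := by
  let : MeasurableSpace E := borel E
  have : BorelSpace E := ⟨rfl⟩
  have hm : Measurable Z' := h.1
  refine WeakConv.of_eventually_measure_closed_le h.1 fun F hF η hη => ?_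
  have : IsProbabilityMeasure (P'.map Z') := Measure.isProbabilityMeasure_map hm.aemeasurable
  have hη3 : 0 < η / 3 := ENNReal.div_pos hη.ne' (by norm_num)
  have hlim := tendsto_measure_cthickening_of_isClosed (μ := P'.map Z') (s := F)
    ⟨1, one_pos, measure_ne_top _ _⟩ hF
  rw [Measure.map_apply hm hF.measurableSet] at hlim
  have hev := hlim.eventually_le_const (ENNReal.lt_add_right (measure_ne_top P' _) hη3.ne')
  obtain ⟨ε, hε, hε0⟩ := ((hev.filter_mono nhdsWithin_le_nhds).and
    (self_mem_nhdsWithin (a := (0 : ℝ)) (s := Set.Ioi 0))).exists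
  rw [Measure.map_apply hm Metric.isClosed_cthickening.measurableSet] at hε
  filter_upwards [h.eventually_measure_closed_le
      (Metric.isClosed_cthickening (δ := ε) (E := F)) hη3,
    ENNReal.tendsto_nhds_zero.1 (hd ε hε0) _ hη3] with n h1 h2
  calc P {ω | Y n ω ∈ F}
      ≤ P ({ω | Z n ω ∈ Metric.cthickening ε F} ∪ {ω | ε < dist (Y n ω) (Z n ω)}) := by
        refine measure_mono fun ω hω => ?_
        by_cases hlt : ε < dist (Y n ω) (Z n ω)
        · exact Or.inr hlt
        · refine Or.inl (Metric.mem_cthickening_of_dist_le _ (Y n ω) _ _ hω ?_)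
          rw [dist_comm]; exact not_lt.1 hlt
    _ ≤ _ := measure_union_le _ _
    _ ≤ (P' (Z' ⁻¹' F) + η / 3 + η / 3) + η / 3 := by gcongr; exact h1.trans (by gcongr)
    _ = P' (Z' ⁻¹' F) + η := by
        rw [add_assoc, add_assoc]; congr 1; rw [← add_assoc, ENNReal.add_thirds]

end WeakConvergence

/-! ### Empirical likelihood of a real sample -/

section EmpiricalLikelihood

variable {n : ℕ} {a : Fin n → ℝ}

/-- Weak duality: every `t` with `1 + t aᵢ > 0` bounds all feasible products. -/
lemma prod_mul_weight_le (hn : 0 < n) {t : ℝ} (ht : ∀ i, 0 < 1 + t * a i) {w : Fin n → ℝ}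
    (hw : ∀ i, 0 ≤ w i) (h1 : ∑ i, w i = 1) (h0 : ∑ i, w i * a i = 0) :
    ∏ i, ((n : ℝ) * w i) ≤ Real.exp (-∑ i, Real.log (1 + t * a i)) := by
  have hn' : (0 : ℝ) < n := by exact_mod_cast hn
  have hprod : ∏ i, (n * w i * (1 + t * a i)) ≤ 1 := by
    calc ∏ i, (n * w i * (1 + t * a i))
        ≤ ∏ i, Real.exp (n * w i * (1 + t * a i) - 1) := by
          refine Finset.prod_le_prod (fun i _ => ?_) fun i _ => ?_
          · have := hw i
            have := (ht i).le
            positivity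
          · linarith [Real.add_one_le_exp (n * w i * (1 + t * a i) - 1)]
      _ = Real.exp (n * ∑ i, w i + n * t * ∑ i, w i * a i - n) := by
          rw [← Real.exp_sum]
          congr 1
          rw [Finset.sum_sub_distrib, Finset.mul_sum, Finset.mul_sum, ← Finset.sum_add_distrib]
          simp only [Finset.sum_const, Finset.card_univ, Fintype.card_fin, nsmul_eq_mul, mul_one]
          congr 1
          exact Finset.sum_congr rfl fun i _ => by ring
      _ = 1 := by rw [h1, h0]; simp
  have hpos : 0 < ∏ i, (1 + t * a i) := Finset.prod_pos fun i _ => ht i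
  rw [Real.exp_neg, Real.exp_sum, Finset.prod_congr rfl fun i _ => Real.exp_log (ht i),
    ← one_div, le_div_iff₀ hpos, ← Finset.prod_mul_distrib]
  exact hprod

lemma empLik_le_exp (hn : 0 < n) {t : ℝ} (ht : ∀ i, 0 < 1 + t * a i) :
    empLik a ≤ Real.exp (-∑ i, Real.log (1 + t * a i)) := by
  refine Real.sSup_le ?_ (Real.exp_pos _).le
  rintro _ ⟨w, hw, h1, h0, rfl⟩
  exact prod_mul_weight_le hn ht hw h1 h0

lemma le_empLik (hn : 0 < n) {w : Fin n → ℝ}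
    (hw : ∀ i, 0 ≤ w i) (h1 : ∑ i, w i = 1) (h0 : ∑ i, w i * a i = 0) :
    ∏ i, ((n : ℝ) * w i) ≤ empLik a := by
  -- the dual point `0` shows that the feasible products are bounded by `1`
  refine le_csSup ⟨1, ?_⟩ ⟨w, hw, h1, h0, rfl⟩
  rintro _ ⟨w, hw, h1, h0, rfl⟩
  simpa using prod_mul_weight_le (t := 0) hn (by simp) hw h1 h0

lemma empLik_nonneg : 0 ≤ empLik a := by
  refine Real.sSup_nonneg ?_
  rintro _ ⟨w, hw, h1, h0, rfl⟩
  exact Finset.prod_nonneg fun i _ => mul_nonneg (Nat.cast_nonneg _) (hw i)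

lemma ofReal_le_negTwoLogEL (hn : 0 < n) {t : ℝ} (ht : ∀ i, 0 < 1 + t * a i) :
    ENNReal.ofReal (2 * ∑ i, Real.log (1 + t * a i)) ≤ negTwoLogEL a := by
  unfold negTwoLogEL
  split_ifs with h
  · exact le_top
  · have hpos : 0 < empLik a := lt_of_le_of_ne empLik_nonneg (Ne.symm h)
    have := Real.log_le_log hpos (empLik_le_exp hn ht)
    rw [Real.log_exp] at this
    exact ENNReal.ofReal_le_ofReal (by linarith)

lemma negTwoLogEL_le_ofReal (hn : 0 < n) {w : Fin n → ℝ}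
    (hw : ∀ i, 0 < w i) (h1 : ∑ i, w i = 1) (h0 : ∑ i, w i * a i = 0) :
    negTwoLogEL a ≤ ENNReal.ofReal (-2 * ∑ i, Real.log (n * w i)) := by
  have hn' : (0 : ℝ) < n := by exact_mod_cast hn
  have hle := le_empLik hn (fun i => (hw i).le) h1 h0
  have hp : 0 < ∏ i, ((n : ℝ) * w i) := Finset.prod_pos fun i _ => mul_pos hn' (hw i)
  have hlog := Real.log_le_log hp hle
  rw [Real.log_prod fun i _ => (mul_pos hn' (hw i)).ne'] at hlog
  unfold negTwoLogEL
  rw [if_neg (hp.trans_le hle).ne']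
  exact ENNReal.ofReal_le_ofReal (by linarith)

/-- Second order expansion of the logarithm, with the cubic error written as a small multiple of the
square so that it can be summed over the sample. -/
lemma log_one_sub_bound {x ρ : ℝ} (hx : |x| ≤ ρ) (hρ : ρ ≤ 1 / 2) :
    |x + x ^ 2 / 2 + Real.log (1 - x)| ≤ 2 * ρ * x ^ 2 := by
  have h := Real.abs_log_sub_add_sum_range_le (x := x) (by linarith) 2
  simp only [Finset.sum_range_succ, Finset.sum_range_zero] at h
  norm_num at h
  refine h.trans ?_
  rw [div_le_iff₀ (by linarith)]
  have h3 : |x| ^ 3 ≤ ρ * x ^ 2 := by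
    rw [← sq_abs x]; nlinarith [sq_nonneg |x|]
  have : 0 ≤ ρ * x ^ 2 := mul_nonneg ((abs_nonneg x).trans hx) (sq_nonneg x)
  nlinarith

/-- Lower bound for `-2 log EL`, from the dual point `t`. -/
lemma negTwoLogEL_ge (hn : 0 < n) {t ρ : ℝ} (hρ : ρ ≤ 1 / 2) (ht : ∀ i, |t * a i| ≤ ρ) :
    ENNReal.ofReal (2 * (t * ∑ i, a i) - (1 + 4 * ρ) * (t ^ 2 * ∑ i, a i ^ 2)) ≤
      negTwoLogEL a := by
  refine le_trans (ENNReal.ofReal_le_ofReal ?_) (ofReal_le_negTwoLogEL hn (t := t) fun i => ?_)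
  · rw [Finset.mul_sum, Finset.mul_sum, Finset.mul_sum, Finset.mul_sum, Finset.mul_sum,
      ← Finset.sum_sub_distrib]
    refine Finset.sum_le_sum fun i _ => ?_
    have := (abs_le.1 (log_one_sub_bound (x := -(t * a i)) (by rw [abs_neg]; exact ht i) hρ)).1
    rw [sub_neg_eq_add] at this
    nlinarith
  · have := (abs_le.1 (ht i)).1
    linarith

/-- Upper bound for `-2 log EL`, from the weights `(1 - m / D * (aᵢ - m)) / n`, where `m` is the
mean and `D` the variance of the sample. -/
lemma negTwoLogEL_le (hn : 0 < n) {m D ρ : ℝ} (hm : ∑ i, a i = n * m)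
    (hD : ∑ i, a i ^ 2 = n * (D + m ^ 2)) (hD0 : 0 < D) (hρ : ρ ≤ 1 / 2)
    (ht : ∀ i, |m / D * (a i - m)| ≤ ρ) :
    negTwoLogEL a ≤ ENNReal.ofReal ((1 + 4 * ρ) * (n * m ^ 2 / D)) := by
  have hn' : (0 : ℝ) < n := by exact_mod_cast hn
  set x : Fin n → ℝ := fun i => m / D * (a i - m) with hx
  have hx1 : ∑ i, x i = 0 := by
    simp only [hx]
    rw [← Finset.mul_sum, Finset.sum_sub_distrib, hm]
    simp
  have hx2 : ∑ i, x i ^ 2 = n * m ^ 2 / D := by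
    have : ∀ i, x i ^ 2 = (m / D) ^ 2 * (a i ^ 2 - 2 * m * a i + m ^ 2) := fun i => by
      simp only [hx]; ring
    rw [Finset.sum_congr rfl fun i _ => this i, ← Finset.mul_sum, Finset.sum_add_distrib,
      Finset.sum_sub_distrib, ← Finset.mul_sum, hm, hD]
    simp only [Finset.sum_const, Finset.card_univ, Fintype.card_fin, nsmul_eq_mul]
    field_simp
    ring
  have hxa : ∑ i, x i * a i = n * m := by
    have : ∀ i, x i * a i = (m / D) * (a i ^ 2 - m * a i) := fun i => by simp only [hx]; ring
    rw [Finset.sum_congr rfl fun i _ => this i, ← Finset.mul_sum,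
      Finset.sum_sub_distrib, ← Finset.mul_sum, hm, hD]
    field_simp
    ring
  refine (negTwoLogEL_le_ofReal hn (w := fun i => (1 - x i) / n) (fun i => ?_) ?_ ?_).trans
    (ENNReal.ofReal_le_ofReal ?_)
  · have := (abs_le.1 (ht i)).2
    have h2 : x i ≤ ρ := this
    exact div_pos (by linarith) hn'
  · rw [← Finset.sum_div, Finset.sum_sub_distrib, hx1]
    simp [hn'.ne']
  · have : ∀ i, (1 - x i) / n * a i = (a i - x i * a i) / n := fun i => by ring
    rw [Finset.sum_congr rfl fun i _ => this i, ← Finset.sum_div, Finset.sum_sub_distrib, hm, hxa]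
    simp
  · have hterm : ∀ i, -2 * Real.log (n * ((1 - x i) / n)) ≤ 2 * x i + (1 + 4 * ρ) * x i ^ 2 := by
      intro i
      rw [mul_div_cancel₀ _ hn'.ne']
      have := (abs_le.1 (log_one_sub_bound (x := x i) (ht i) hρ)).1
      nlinarith
    rw [Finset.mul_sum]
    refine (Finset.sum_le_sum fun i _ => hterm i).trans (le_of_eq ?_)
    have e1 : ∑ i, 2 * x i = 0 := by rw [← Finset.mul_sum, hx1, mul_zero]
    rw [Finset.sum_add_distrib, e1, ← Finset.mul_sum, hx2, zero_add]

/-- Wilks expansion with a uniform error: `-2 log EL` is close to the squared normalized sum divided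
by the limiting second moment. -/
lemma exists_negTwoLogEL_approx {K c ε : ℝ} (hK : 0 < K) (hc : 0 < c) (hε : 0 < ε) :
    ∃ δ : ℝ, 0 < δ ∧ ∀ n : ℕ, 0 < n → ∀ (a : Fin n → ℝ) (T : ℝ), c ≤ T →
      |(√(n : ℝ))⁻¹ * ∑ i, a i| ≤ K → |(n : ℝ)⁻¹ * ∑ i, a i ^ 2 - T| ≤ δ →
      (∀ i, |a i| ≤ δ * √(n : ℝ)) →
      negTwoLogEL a ≠ ∞ ∧
        |(negTwoLogEL a).toReal - ((√(n : ℝ))⁻¹ * ∑ i, a i) ^ 2 / T| ≤ ε := by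
  -- The first summand of `B` bounds the effect of replacing `S` or `D = S - m ^ 2` by `T`, the
  -- second that of the cubic terms of the logarithm.
  set B : ℝ := 4 * K ^ 2 * (1 + K) / c ^ 2 + 128 * K ^ 3 / c ^ 2 with hB
  have hB0 : 0 < B := by positivity
  refine ⟨min (c / 4) (min (c / (64 * K)) (ε / B)), by positivity, ?_⟩
  set δ : ℝ := min (c / 4) (min (c / (64 * K)) (ε / B)) with hδ
  have hδ0 : 0 < δ := by positivity
  have hδc : δ ≤ c / 4 := min_le_left _ _
  have hδK : K * δ ≤ c / 64 := by
    have : δ ≤ c / (64 * K) := (min_le_right _ _).trans (min_le_left _ _)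
    rw [le_div_iff₀ (by positivity)] at this
    linarith
  have hδε : δ * B ≤ ε := by
    have : δ ≤ ε / B := (min_le_right _ _).trans (min_le_right _ _)
    rwa [le_div_iff₀ hB0] at this
  intro n hn a T hT hR hS ha
  have hn' : (0 : ℝ) < n := by exact_mod_cast hn
  have hs0 : 0 < √(n : ℝ) := Real.sqrt_pos.2 hn'
  have hss : √(n : ℝ) * √(n : ℝ) = n := Real.mul_self_sqrt hn'.le
  set R : ℝ := (√(n : ℝ))⁻¹ * ∑ i, a i with hRdef
  set S : ℝ := (n : ℝ)⁻¹ * ∑ i, a i ^ 2 with hSdef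
  set m : ℝ := R / √(n : ℝ) with hmdef
  have hsum : ∑ i, a i = n * m := by
    rw [hmdef, hRdef]; nth_rewrite 1 [← hss]; field_simp
  have hsq : ∑ i, a i ^ 2 = n * S := by rw [hSdef]; field_simp
  have hnm : n * m ^ 2 = R ^ 2 := by rw [hmdef, div_pow, sq √(n : ℝ), hss]; field_simp
  have hR2 : R ^ 2 ≤ K ^ 2 := by rw [← sq_abs]; gcongr
  have hmK : |m| * √(n : ℝ) ≤ K := by
    rw [hmdef, abs_div, abs_of_pos hs0, div_mul_cancel₀ _ hs0.ne']; exact hR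
  have hma : ∀ i, |m| * |a i| ≤ K * δ := fun i => by
    calc |m| * |a i| ≤ |m| * (δ * √(n : ℝ)) := by gcongr; exact ha i
      _ = |m| * √(n : ℝ) * δ := by ring
      _ ≤ K * δ := by gcongr
  have hm2 : m ^ 2 ≤ K * δ := by
    have h1 : |∑ i, a i| ≤ n * (δ * √(n : ℝ)) := by
      refine (Finset.abs_sum_le_sum_abs _ _).trans ((Finset.sum_le_sum fun i _ => ha i).trans ?_)
      simp
    rw [hsum, abs_mul, abs_of_pos hn'] at h1
    have h2 := le_of_mul_le_mul_left h1 hn'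
    calc m ^ 2 = |m| * |m| := by rw [← sq_abs]; ring
      _ ≤ |m| * (δ * √(n : ℝ)) := by gcongr
      _ = |m| * √(n : ℝ) * δ := by ring
      _ ≤ K * δ := by gcongr
  obtain ⟨hS1, hS2⟩ := abs_le.1 hS
  have hT0 : 0 < T := hc.trans_le hT
  have hSc : c / 2 ≤ S := by linarith
  have hS0 : 0 < S := by linarith
  -- `|m / S * aᵢ| ≤ ρ` at the dual point
  set ρ : ℝ := 2 * (K * δ) / c with hρ
  have hρ1 : ρ ≤ 1 / 32 := by rw [hρ, div_le_iff₀ hc]; linarith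
  have hρ0 : 0 ≤ ρ := by positivity
  have hlow := negTwoLogEL_ge (a := a) hn (t := m / S) (ρ := ρ) (by linarith) (fun i => by
    rw [div_mul_eq_mul_div, abs_div, abs_mul, abs_of_pos hS0, div_le_iff₀ hS0]
    calc |m| * |a i| ≤ K * δ := hma i
      _ = ρ * (c / 2) := by rw [hρ]; field_simp
      _ ≤ ρ * S := by gcongr)
  have hlow' : 2 * (m / S * ∑ i, a i) - (1 + 4 * ρ) * ((m / S) ^ 2 * ∑ i, a i ^ 2) =
      (1 - 4 * ρ) * (R ^ 2 / S) := by
    rw [hsum, hsq, ← hnm]; field_simp; ring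
  rw [hlow'] at hlow
  -- the weights built from `m` and the variance `D`
  set D : ℝ := S - m ^ 2 with hD
  have hDc : c / 4 ≤ D := by linarith
  have hD0 : 0 < D := by linarith
  have hup := negTwoLogEL_le (a := a) hn (m := m) (D := D) (ρ := 4 * ρ) hsum
    (by rw [hsq, hD]; ring) hD0 (by linarith) (fun i => by
    rw [div_mul_eq_mul_div, abs_div, abs_mul, abs_of_pos hD0, div_le_iff₀ hD0]
    calc |m| * |a i - m| ≤ |m| * (|a i| + |m|) := by gcongr; exact abs_sub _ _
      _ = |m| * |a i| + m ^ 2 := by rw [← sq_abs m]; ring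
      _ ≤ K * δ + K * δ := add_le_add (hma i) hm2
      _ = 4 * ρ * (c / 4) := by rw [hρ]; field_simp; norm_num
      _ ≤ 4 * ρ * D := by gcongr)
  rw [hnm] at hup
  have hfin : negTwoLogEL a ≠ ∞ := ne_top_of_le_ne_top ENNReal.ofReal_ne_top hup
  refine ⟨hfin, ?_⟩
  have hup' := ENNReal.toReal_le_of_le_ofReal (by positivity) hup
  have hlow'' := (ENNReal.ofReal_le_iff_le_toReal hfin).1 hlow
  have h4 : K ^ 2 / (c / 4) = 4 * K ^ 2 / c := by field_simp
  have hRD : R ^ 2 / D ≤ 4 * K ^ 2 / c := by rw [← h4]; gcongr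
  have hRS : R ^ 2 / S ≤ 4 * K ^ 2 / c := by rw [← h4]; gcongr; linarith
  have hRT : R ^ 2 / T ≤ K ^ 2 / c := by gcongr
  have e1 : R ^ 2 / T - R ^ 2 / S = R ^ 2 / T * (S - T) / S := by field_simp
  have e2 : R ^ 2 / D - R ^ 2 / T = R ^ 2 / T * (T - D) / D := by field_simp
  have hRT0 : 0 ≤ R ^ 2 / T := by positivity
  have b1 : R ^ 2 / T - R ^ 2 / S ≤ 4 * K ^ 2 * (1 + K) / c ^ 2 * δ := by
    rw [e1, div_le_iff₀ hS0]
    calc R ^ 2 / T * (S - T) ≤ R ^ 2 / T * δ := by gcongr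
      _ ≤ K ^ 2 / c * δ := by gcongr
      _ ≤ K ^ 2 * (1 + K) / c * δ := by
        gcongr
        exact le_mul_of_one_le_right (sq_nonneg K) (by linarith)
      _ = 4 * K ^ 2 * (1 + K) / c ^ 2 * δ * (c / 4) := by field_simp
      _ ≤ 4 * K ^ 2 * (1 + K) / c ^ 2 * δ * S := by gcongr; linarith
  have b2 : R ^ 2 / D - R ^ 2 / T ≤ 4 * K ^ 2 * (1 + K) / c ^ 2 * δ := by
    rw [e2, div_le_iff₀ hD0]
    calc R ^ 2 / T * (T - D) ≤ R ^ 2 / T * (δ + K * δ) := by gcongr; linarith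
      _ ≤ K ^ 2 / c * (δ + K * δ) := by gcongr
      _ = 4 * K ^ 2 * (1 + K) / c ^ 2 * δ * (c / 4) := by field_simp
      _ ≤ 4 * K ^ 2 * (1 + K) / c ^ 2 * δ * D := by gcongr
  have b3 : 16 * ρ * (4 * K ^ 2 / c) = 128 * K ^ 3 / c ^ 2 * δ := by
    rw [hρ]; field_simp; norm_num
  have b4 : 16 * ρ * (R ^ 2 / D) ≤ 128 * K ^ 3 / c ^ 2 * δ := by
    rw [← b3]; gcongr
  have b5 : 4 * ρ * (R ^ 2 / S) ≤ 128 * K ^ 3 / c ^ 2 * δ := by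
    rw [← b3]; gcongr; linarith
  have hBe : 4 * K ^ 2 * (1 + K) / c ^ 2 * δ + 128 * K ^ 3 / c ^ 2 * δ ≤ ε := by
    rw [← add_mul, mul_comm]; exact hδε
  have e3 : (1 + 4 * (4 * ρ)) * (R ^ 2 / D) = R ^ 2 / D + 16 * ρ * (R ^ 2 / D) := by ring
  have e4 : (1 - 4 * ρ) * (R ^ 2 / S) = R ^ 2 / S - 4 * ρ * (R ^ 2 / S) := by ring
  rw [e3] at hup'
  rw [e4] at hlow''
  rw [abs_le]
  constructor <;> linarith

end EmpiricalLikelihood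

/-! ### Boxes, distribution functions and lower integrals -/

section Boxes

variable {k : ℕ} {U : Set (Fin k → ℝ)} {μ ν : Measure U}

lemma measurableSet_boxTrace {B : Fin k → Set ℝ} (hB : ∀ i, (B i).OrdConnected) :
    MeasurableSet (boxTrace U B) := by
  have : boxTrace U B = ⋂ i, (fun u : U => (u : Fin k → ℝ) i) ⁻¹' (B i) := by
    ext u; simp [boxTrace]
  rw [this]
  exact MeasurableSet.iInter fun i =>
    ((measurable_pi_apply i).comp measurable_subtype_coe) (hB i).measurableSet

lemma exists_monotone_iUnion_Iic_of_isLowerSet {J : Set ℝ} (hJ : IsLowerSet J)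
    (hne : J.Nonempty) : ∃ a : ℕ → ℝ, Monotone a ∧ J = ⋃ m, Set.Iic (a m) := by
  have := hJ.ordConnected
  have : Nonempty J := hne.to_subtype
  obtain ⟨a, ha, hlim⟩ := exists_seq_monotone_tendsto_atTop_atTop J
  refine ⟨fun m => a m, fun i j hij => ha hij, Set.Subset.antisymm (fun x hx => ?_) ?_⟩
  · obtain ⟨m, hm⟩ := (hlim.eventually_ge_atTop ⟨x, hx⟩).exists
    exact Set.mem_iUnion.2 ⟨m, hm⟩
  · exact Set.iUnion_subset fun m x hx => hJ hx (a m).2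

variable [IsFiniteMeasure μ] [IsFiniteMeasure ν] {δ : ℝ}

/-- The bound on the difference of distribution functions passes to open, closed or unbounded
lower orthants, which are increasing unions of closed ones. -/
lemma abs_measureReal_orthant_sub_le (h : ∀ x, |distFun ν x - distFun μ x| ≤ δ)
    {J : Fin k → Set ℝ} (hJ : ∀ i, IsLowerSet (J i)) :
    |ν.real (boxTrace U J) - μ.real (boxTrace U J)| ≤ δ := by
  by_cases hne : ∀ i, (J i).Nonempty
  · choose a ha hJa using fun i => exists_monotone_iUnion_Iic_of_isLowerSet (hJ i) (hne i)
    set s : ℕ → Set U := fun m => {v : U | (v : Fin k → ℝ) ≤ fun i => a i m} with hs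
    have hmono : Monotone s := fun m m' hm v hv i => (hv i).trans (ha i hm)
    have hU : boxTrace U J = ⋃ m, s m := by
      ext v
      simp only [boxTrace, Set.mem_ofPred_eq, Set.mem_iUnion, hs]
      constructor
      · intro hv
        have : ∀ i, ∃ m, (v : Fin k → ℝ) i ≤ a i m := fun i => by
          have := hv i
          rw [hJa i] at this
          simpa using this
        choose m hm using this
        exact ⟨Finset.univ.sup m, fun i => (hm i).trans (ha i (Finset.le_sup (Finset.mem_univ i)))⟩
      · rintro ⟨m, hm⟩ i
        rw [hJa i]
        exact Set.mem_iUnion.2 ⟨m, hm i⟩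
    have key : ∀ (ρ : Measure U) [IsFiniteMeasure ρ],
        Tendsto (fun m => ρ.real (s m)) atTop (𝓝 (ρ.real (boxTrace U J))) := by
      intro ρ _
      rw [hU]
      exact (ENNReal.tendsto_toReal (measure_ne_top ρ _)).comp
        (tendsto_measure_iUnion_atTop hmono)
    exact le_of_tendsto ((key ν).sub (key μ)).abs (Eventually.of_forall fun m => h _)
  · push Not at hne
    obtain ⟨i, hi⟩ := hne
    have : boxTrace U J = ∅ := by
      ext v
      simp only [boxTrace, Set.mem_ofPred_eq, Set.mem_empty_iff_false, iff_false]
      intro hv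
      have := hv i
      simp [hi] at this
    rw [this]
    simpa using (abs_nonneg _).trans (h 0)

/-- Each interval is a difference of two lower sets, so a box is reached in `k` steps, each of which
doubles the bound. -/
lemma abs_measureReal_mixedBox_sub_le (h : ∀ x, |distFun ν x - distFun μ x| ≤ δ)
    (s : Finset (Fin k)) : ∀ {B : Fin k → Set ℝ}, (∀ i ∈ s, (B i).OrdConnected) →
    (∀ i ∉ s, IsLowerSet (B i)) →
    |ν.real (boxTrace U B) - μ.real (boxTrace U B)| ≤ 2 ^ s.card * δ := by
  induction s using Finset.induction_on with
  | empty =>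
    intro B _ hB
    simpa using abs_measureReal_orthant_sub_le h fun i => hB i (by simp)
  | insert j s hj ih =>
    intro B hB hB'
    have hBj := hB j (Finset.mem_insert_self _ _)
    -- `B j = J₂ \ J₁` for lower sets `J₁ ⊆ J₂`
    set J₂ : Set ℝ := (lowerClosure (B j) : Set ℝ) with hJ₂
    set J₁ : Set ℝ := J₂ \ B j with hJ₁
    have hl₂ : IsLowerSet J₂ := (lowerClosure (B j)).lower
    have hl₁ : IsLowerSet J₁ := by
      intro x y hyx hx
      refine ⟨hl₂ hyx hx.1, fun hy => hx.2 ?_⟩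
      obtain ⟨w, hw, hxw⟩ := mem_lowerClosure.1 hx.1
      exact hBj.out hy hw ⟨hyx, hxw⟩
    have hsub : B j ⊆ J₂ := subset_lowerClosure
    have hih : ∀ J : Set ℝ, IsLowerSet J →
        |ν.real (boxTrace U (Function.update B j J)) - μ.real (boxTrace U (Function.update B j J))|
          ≤ 2 ^ s.card * δ := by
      intro J hJ
      refine ih (fun i hi => ?_) fun i hi => ?_
      · rw [Function.update_of_ne (by rintro rfl; exact hj hi)]
        exact hB i (Finset.mem_insert_of_mem hi)
      · by_cases hij : i = j
        · subst hij; simpa using hJ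
        · rw [Function.update_of_ne hij]
          exact hB' i (by simp [hij, hi])
    have hOC : ∀ i, (B i).OrdConnected := fun i => by
      by_cases hi : i ∈ insert j s
      · exact hB i hi
      · exact (hB' i hi).ordConnected
    have hmem : ∀ (J : Set ℝ) (v : U), v ∈ boxTrace U (Function.update B j J) ↔
        (v : Fin k → ℝ) j ∈ J ∧ ∀ i, i ≠ j → (v : Fin k → ℝ) i ∈ B i := by
      intro J v
      simp only [boxTrace, Set.mem_ofPred_eq]
      constructor
      · intro hv
        refine ⟨by simpa using hv j, fun i hi => by simpa [hi] using hv i⟩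
      · rintro ⟨h1, h2⟩ i
        by_cases hij : i = j
        · subst hij; simpa using h1
        · simpa [hij] using h2 i hij
    have hunion : boxTrace U (Function.update B j J₂) =
        boxTrace U (Function.update B j J₁) ∪ boxTrace U B := by
      ext v
      have hB0 : v ∈ boxTrace U B ↔ (v : Fin k → ℝ) j ∈ B j ∧
          ∀ i, i ≠ j → (v : Fin k → ℝ) i ∈ B i := by
        have := hmem (B j) v
        rwa [Function.update_eq_self] at this
      rw [Set.mem_union, hmem, hmem, hB0, hJ₁, Set.mem_sdiff]
      have := @hsub ((v : Fin k → ℝ) j)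
      tauto
    have hdisj : Disjoint (boxTrace U (Function.update B j J₁)) (boxTrace U B) := by
      rw [Set.disjoint_left]
      intro v hv hv'
      exact ((hmem _ v).1 hv).1.2 (hv' j)
    have hadd : ∀ (ρ : Measure U) [IsFiniteMeasure ρ],
        ρ.real (boxTrace U (Function.update B j J₂)) =
          ρ.real (boxTrace U (Function.update B j J₁)) + ρ.real (boxTrace U B) := by
      intro ρ _
      rw [hunion, measureReal_union hdisj (measurableSet_boxTrace hOC)]
    have h1 := abs_le.1 (hih J₁ hl₁)
    have h2 := abs_le.1 (hih J₂ hl₂)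
    rw [hadd ν, hadd μ] at h2
    rw [Finset.card_insert_of_notMem hj, pow_succ, abs_le]
    constructor <;> linarith [h1.1, h1.2, h2.1, h2.2]

lemma abs_measureReal_box_sub_le (h : ∀ x, |distFun ν x - distFun μ x| ≤ δ)
    {B : Fin k → Set ℝ} (hB : ∀ i, (B i).OrdConnected) :
    |ν.real (boxTrace U B) - μ.real (boxTrace U B)| ≤ 2 ^ k * δ := by
  simpa using abs_measureReal_mixedBox_sub_le h Finset.univ (B := B) (fun i _ => hB i) (by simp)

/-- Inclusion-exclusion: the bound for a box from which finitely many boxes are removed. -/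
lemma abs_measureReal_box_diff_sub_le {ι : Type*} (h : ∀ x, |distFun ν x - distFun μ x| ≤ δ)
    {C : ι → Fin k → Set ℝ} (hC : ∀ j i, (C j i).OrdConnected) (s : Finset ι) :
    ∀ {B : Fin k → Set ℝ}, (∀ i, (B i).OrdConnected) →
    |ν.real (boxTrace U B \ ⋃ j ∈ s, boxTrace U (C j)) -
      μ.real (boxTrace U B \ ⋃ j ∈ s, boxTrace U (C j))| ≤ 2 ^ s.card * (2 ^ k * δ) := by
  classical
  induction s using Finset.induction_on with
  | empty =>
    intro B hB
    simpa using abs_measureReal_box_sub_le h hB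
  | insert j s hj ih =>
    intro B hB
    have hBC : ∀ i, (B i ∩ C j i).OrdConnected := fun i => (hB i).inter (hC j i)
    have h1 := abs_le.1 (ih hB)
    have h2 := abs_le.1 (ih hBC)
    set W : Set U := ⋃ i ∈ s, boxTrace U (C i) with hW
    have hWm : MeasurableSet W := s.measurableSet_biUnion fun i _ => measurableSet_boxTrace (hC i)
    have hunion : boxTrace U B \ W = (boxTrace U B \ ⋃ i ∈ insert j s, boxTrace U (C i)) ∪
        (boxTrace U (fun i => B i ∩ C j i) \ W) := by
      have e : boxTrace U (fun i => B i ∩ C j i) = boxTrace U B ∩ boxTrace U (C j) := by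
        ext v; simp [boxTrace, forall_and]
      rw [Finset.set_biUnion_insert, e]
      ext v
      simp only [Set.mem_sdiff, Set.mem_union, Set.mem_inter_iff, ← hW]
      tauto
    have hdisj : Disjoint (boxTrace U B \ ⋃ i ∈ insert j s, boxTrace U (C i))
        (boxTrace U (fun i => B i ∩ C j i) \ W) := by
      rw [Finset.set_biUnion_insert, Set.disjoint_left]
      intro v hv hv'
      exact hv.2 (Or.inl fun i => (hv'.1 i).2)
    have hadd : ∀ (ρ : Measure U) [IsFiniteMeasure ρ], ρ.real (boxTrace U B \ W) =
        ρ.real (boxTrace U B \ ⋃ i ∈ insert j s, boxTrace U (C i)) +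
          ρ.real (boxTrace U (fun i => B i ∩ C j i) \ W) := by
      intro ρ _
      conv_lhs => rw [hunion]
      exact measureReal_union hdisj ((measurableSet_boxTrace hBC).diff hWm)
    rw [hadd ν, hadd μ] at h1
    rw [Finset.card_insert_of_notMem hj, pow_succ, abs_le]
    constructor <;> linarith [h1.1, h1.2, h2.1, h2.2]

end Boxes

section LowerIntegral

/-- Comparison of lower integrals with respect to two measures that are close on the atoms of a
finite partition, for a function that oscillates little on the atoms outside `J`.  The function
need not be measurable. -/
lemma lintegral_le_of_partition {α ι : Type*} [MeasurableSpace α] [Fintype ι] {ν ν' : Measure α}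
    {D : ι → Set α} (hD : ∀ j, MeasurableSet (D j)) (hdisj : Pairwise (Function.onFun Disjoint D))
    (hcov : ⋃ j, D j = Set.univ) {η ε M : ℝ≥0∞} (hη : ∀ j, ν (D j) ≤ ν' (D j) + η)
    {f : α → ℝ≥0∞} (hf : ∀ v, f v ≤ M) (J : Finset ι)
    (hJ : ∀ j ∉ J, ∀ v ∈ D j, ∀ v' ∈ D j, f v ≤ f v' + ε) :
    ∫⁻ v, f v ∂ν ≤ ∫⁻ v, f v ∂ν' + ε * ν' Set.univ + M * ∑ j ∈ J, ν' (D j) +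
      Fintype.card ι * (M * η) := by
  classical
  have hsplit : ∀ ρ : Measure α, ∫⁻ v, f v ∂ρ = ∑ j, ∫⁻ v in D j, f v ∂ρ := by
    intro ρ
    rw [← setLIntegral_univ, ← hcov, lintegral_iUnion hD hdisj, tsum_fintype]
  have huniv : ν' Set.univ = ∑ j, ν' (D j) := by
    rw [← hcov, measure_iUnion hdisj hD, tsum_fintype]
  have hatom : ∀ j, ∫⁻ v in D j, f v ∂ν ≤ ∫⁻ v in D j, f v ∂ν' + ε * ν' (D j) +
      M * (if j ∈ J then ν' (D j) else 0) + M * η := by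
    intro j
    set b : ℝ≥0∞ := ⨆ v ∈ D j, f v with hb
    have hbM : b ≤ M := iSup₂_le fun v _ => hf v
    have h1 : ∫⁻ v in D j, f v ∂ν ≤ b * ν' (D j) + M * η := by
      calc ∫⁻ v in D j, f v ∂ν ≤ ∫⁻ _ in D j, b ∂ν :=
            setLIntegral_mono' (hD j) fun v hv => le_iSup₂ (f := fun v (_ : v ∈ D j) => f v) v hv
        _ = b * ν (D j) := by rw [setLIntegral_const]
        _ ≤ b * (ν' (D j) + η) := by gcongr; exact hη j
        _ = b * ν' (D j) + b * η := mul_add _ _ _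
        _ ≤ _ := by gcongr
    refine h1.trans (add_le_add ?_ le_rfl)
    by_cases hj : j ∈ J
    · rw [if_pos hj]
      exact le_trans (by gcongr) le_add_self
    · rw [if_neg hj, mul_zero, add_zero]
      calc b * ν' (D j) = ∫⁻ _ in D j, b ∂ν' := by rw [setLIntegral_const]
        _ ≤ ∫⁻ v in D j, (f v + ε) ∂ν' := setLIntegral_mono' (hD j) fun v hv =>
            iSup₂_le fun v' hv' => hJ j hj v' hv' v hv
        _ = _ := by rw [lintegral_add_right _ measurable_const, setLIntegral_const]
  rw [hsplit ν, hsplit ν', huniv]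
  refine (Finset.sum_le_sum fun j _ => hatom j).trans (le_of_eq ?_)
  rw [Finset.sum_add_distrib, Finset.sum_add_distrib, Finset.sum_add_distrib, Finset.mul_sum,
    ← Finset.mul_sum, ← Finset.mul_sum]
  simp [Finset.sum_ite_mem, Finset.mul_sum]

variable {k : ℕ} {U : Set (Fin k → ℝ)} {μ ν : Measure U}

/-- There is a cover of `U` by at most `N` boxes such that the union of those on which `f`
oscillates by more than `ε` has measure at most `ε`. -/
def HasBoxCover (μ : Measure U) (N : ℕ) (ε : ℝ) (f : U → ℝ) : Prop :=
  ∃ (N' : ℕ) (B : Fin N' → Fin k → Set ℝ), N' ≤ N ∧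
    (∀ j i, (B j i).OrdConnected) ∧
    (∀ u : U, ∃ j, u ∈ boxTrace U (B j)) ∧
    μ {u : U | ∃ j, u ∈ boxTrace U (B j) ∧
        ∃ v ∈ boxTrace U (B j), ∃ v' ∈ boxTrace U (B j), ε < |f v - f v'|} ≤ ENNReal.ofReal ε

/-- The cover also serves nearby functions, with a larger tolerance. -/
lemma HasBoxCover.of_abs_sub_le {N : ℕ} {ε : ℝ} (hε : 0 < ε) {f g : U → ℝ}
    (h : HasBoxCover μ N ε f) (hfg : ∀ u, |g u - f u| ≤ ε) : HasBoxCover μ N (3 * ε) g := by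
  obtain ⟨N', B, hN, hB, hcov, hbad⟩ := h
  refine ⟨N', B, hN, hB, hcov, (measure_mono ?_).trans
    (hbad.trans (ENNReal.ofReal_le_ofReal (by linarith)))⟩
  rintro u ⟨j, hu, v, hv, v', hv', hlt⟩
  refine ⟨j, hu, v, hv, v', hv', ?_⟩
  have h1 := abs_le.1 (hfg v)
  have h2 := abs_le.1 (hfg v')
  by_contra hle
  have h3 := abs_le.1 (not_lt.1 hle)
  refine absurd hlt (not_lt.2 (abs_le.2 ⟨?_, ?_⟩)) <;> linarith [h1.1, h1.2, h2.1, h2.2, h3.1, h3.2]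

variable [IsFiniteMeasure μ] [IsFiniteMeasure ν]

/-- Lower integrals of a function with a box cover are close if the distribution functions are. -/
lemma lintegral_le_of_hasBoxCover {N : ℕ} {ε δ M : ℝ} (hε : 0 < ε) (hM : 0 ≤ M) {z : U → ℝ}
    (hz : ∀ u, z u ≤ M) (h : HasBoxCover μ N ε z) (hδ : ∀ x, |distFun ν x - distFun μ x| ≤ δ) :
    (∫⁻ u, ENNReal.ofReal (z u) ∂ν ≤ ∫⁻ u, ENNReal.ofReal (z u) ∂μ +
      ENNReal.ofReal (ε * μ.real Set.univ + M * ε + N * (M * (2 ^ N * (2 ^ k * δ))))) ∧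
    (∫⁻ u, ENNReal.ofReal (z u) ∂μ ≤ ∫⁻ u, ENNReal.ofReal (z u) ∂ν +
      ENNReal.ofReal (ε * ν.real Set.univ + M * (ε + N * (2 ^ N * (2 ^ k * δ))) +
        N * (M * (2 ^ N * (2 ^ k * δ))))) := by
  classical
  obtain ⟨N', B, hN, hB, hcov, hbad⟩ := h
  have hδ0 : 0 ≤ δ := (abs_nonneg _).trans (hδ 0)
  have hNr : (N' : ℝ) ≤ N := by exact_mod_cast hN
  set η : ℝ := 2 ^ N * (2 ^ k * δ) with hη
  have hη0 : 0 ≤ η := by positivity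
  -- the cover made disjoint
  set D : Fin N' → Set U := fun j =>
    boxTrace U (B j) \ ⋃ i ∈ Finset.univ.filter (· < j), boxTrace U (B i) with hD
  have hDm : ∀ j, MeasurableSet (D j) := fun j => (measurableSet_boxTrace (hB j)).diff
    (Finset.measurableSet_biUnion _ fun i _ => measurableSet_boxTrace (hB i))
  have hdisj : Pairwise (Function.onFun Disjoint D) := by
    have : ∀ i j, i < j → Disjoint (D i) (D j) := by
      intro i j hij
      rw [Set.disjoint_left]
      intro v hv hv'
      exact hv'.2 (Set.mem_biUnion (by simpa using hij) hv.1)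
    intro i j hij
    rcases lt_or_gt_of_ne hij with h | h
    · exact this i j h
    · exact (this j i h).symm
  have hDcov : ⋃ j, D j = Set.univ := by
    refine Set.eq_univ_of_forall fun u => ?_
    have hne : (Finset.univ.filter fun j => u ∈ boxTrace U (B j)).Nonempty := by
      obtain ⟨j, hj⟩ := hcov u
      exact ⟨j, by simpa using hj⟩
    set j := Finset.min' _ hne with hj
    have hjm := Finset.min'_mem _ hne
    rw [← hj, Finset.mem_filter] at hjm
    refine Set.mem_iUnion.2 ⟨j, hjm.2, fun hu => ?_⟩
    obtain ⟨i, hi, hui⟩ := Set.mem_iUnion₂.1 hu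
    rw [Finset.mem_filter] at hi
    exact absurd (Finset.min'_le _ i (by simpa using hui)) (not_le.2 hi.2)
  have hclose : ∀ j, |ν.real (D j) - μ.real (D j)| ≤ η := by
    intro j
    refine (abs_measureReal_box_diff_sub_le hδ hB _ (hB j)).trans ?_
    have hcard : (Finset.univ.filter (· < j)).card ≤ N :=
      (Finset.card_le_univ _).trans (by simpa using hN)
    rw [hη]
    gcongr
    norm_num
  clear_value η
  have hle : ∀ {ρ ρ' : Measure U} [IsFiniteMeasure ρ] [IsFiniteMeasure ρ'] (j : Fin N'),
      ρ.real (D j) - ρ'.real (D j) ≤ η → ρ (D j) ≤ ρ' (D j) + ENNReal.ofReal η := by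
    intro ρ ρ' _ _ j hj
    rw [← ofReal_measureReal (μ := ρ), ← ofReal_measureReal (μ := ρ'),
      ← ENNReal.ofReal_add measureReal_nonneg hη0]
    exact ENNReal.ofReal_le_ofReal (by linarith)
  have h1 : ∀ j, ν (D j) ≤ μ (D j) + ENNReal.ofReal η := fun j => hle j (abs_le.1 (hclose j)).2
  have h2 : ∀ j, μ (D j) ≤ ν (D j) + ENNReal.ofReal η := fun j =>
    hle j (by linarith [(abs_le.1 (hclose j)).1])
  set J : Finset (Fin N') := Finset.univ.filter fun j =>
    ∃ v ∈ boxTrace U (B j), ∃ v' ∈ boxTrace U (B j), ε < |z v - z v'| with hJ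
  have hosc : ∀ j ∉ J, ∀ v ∈ D j, ∀ v' ∈ D j,
      ENNReal.ofReal (z v) ≤ ENNReal.ofReal (z v') + ENNReal.ofReal ε := by
    intro j hj v hv v' hv'
    have : ¬ ε < |z v - z v'| := fun hlt =>
      hj (Finset.mem_filter.2 ⟨Finset.mem_univ _, v, hv.1, v', hv'.1, hlt⟩)
    exact (ENNReal.ofReal_le_ofReal (by linarith [(abs_le.1 (not_lt.1 this)).2])).trans
      ENNReal.ofReal_add_le
  have hJμ : ∑ j ∈ J, μ (D j) ≤ ENNReal.ofReal ε := by
    rw [← measure_biUnion_finset (fun i _ j _ hij => hdisj hij) fun j _ => hDm j]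
    refine (measure_mono ?_).trans hbad
    intro u hu
    obtain ⟨j, hj, huj⟩ := Set.mem_iUnion₂.1 hu
    exact ⟨j, huj.1, (Finset.mem_filter.1 hj).2⟩
  have hJν : ∑ j ∈ J, ν (D j) ≤ ENNReal.ofReal (ε + N * η) := by
    calc ∑ j ∈ J, ν (D j) ≤ ∑ j ∈ J, (μ (D j) + ENNReal.ofReal η) :=
          Finset.sum_le_sum fun j _ => h1 j
      _ = ∑ j ∈ J, μ (D j) + J.card * ENNReal.ofReal η := by simp [Finset.sum_add_distrib]
      _ ≤ ENNReal.ofReal ε + N * ENNReal.ofReal η := by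
          gcongr
          exact (Finset.card_le_univ _).trans (by simpa using hN)
      _ = ENNReal.ofReal (ε + N * η) := by
          rw [ENNReal.ofReal_add hε.le (by positivity), ENNReal.ofReal_mul (by positivity),
            ENNReal.ofReal_natCast]
  have hzM : ∀ u, ENNReal.ofReal (z u) ≤ ENNReal.ofReal M := fun u =>
    ENNReal.ofReal_le_ofReal (hz u)
  have hcardle : (Fintype.card (Fin N') : ℝ≥0∞) * (ENNReal.ofReal M * ENNReal.ofReal η) ≤
      ENNReal.ofReal (N * (M * η)) := by
    rw [ENNReal.ofReal_mul (by positivity), ENNReal.ofReal_mul hM, ENNReal.ofReal_natCast,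
      Fintype.card_fin]
    gcongr
  constructor
  · refine (lintegral_le_of_partition hDm hdisj hDcov h1 hzM J hosc).trans ?_
    rw [ENNReal.ofReal_add (by positivity) (by positivity),
      ENNReal.ofReal_add (by positivity) (by positivity), ENNReal.ofReal_mul hε.le,
      ENNReal.ofReal_mul hM, ofReal_measureReal, ← add_assoc, ← add_assoc]
    gcongr
  · refine (lintegral_le_of_partition hDm hdisj hDcov h2 hzM J hosc).trans ?_
    rw [ENNReal.ofReal_add (by positivity) (by positivity),
      ENNReal.ofReal_add (by positivity) (by positivity), ENNReal.ofReal_mul hε.le,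
      ENNReal.ofReal_mul hM, ofReal_measureReal, ← add_assoc, ← add_assoc]
    gcongr

end LowerIntegral

/-! ### Maps on bounded functions; negligible events -/

section BoundedPaths

variable {I : Type*}

lemma toLinf_apply {z : I → EReal} (h : IsBddPath z) (u : I) : toLinf z u = (z u).toReal := by
  rw [toLinf, dif_pos h]

lemma isBddPath_of_abs_le {z : I → ℝ} {C : ℝ} (h : ∀ u, |z u| ≤ C) :
    IsBddPath fun u => (z u : EReal) :=
  ⟨C, fun u => ⟨EReal.coe_le_coe_iff.2 (abs_le.1 (h u)).1,
    EReal.coe_le_coe_iff.2 (abs_le.1 (h u)).2⟩⟩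

lemma abs_apply_le_norm (z : lp (fun _ : I => ℝ) ∞) (u : I) : |z u| ≤ ‖z‖ :=
  lp.norm_apply_le_norm ENNReal.top_ne_zero z u

lemma abs_sub_le_dist (z w : lp (fun _ : I => ℝ) ∞) (u : I) : |z u - w u| ≤ dist z w := by
  rw [dist_eq_norm]
  exact abs_apply_le_norm (z - w) u

lemma dist_le_of_forall_abs_sub_le {z w : lp (fun _ : I => ℝ) ∞} {ε : ℝ} (hε : 0 ≤ ε)
    (h : ∀ u, |z u - w u| ≤ ε) : dist z w ≤ ε := by
  rw [dist_eq_norm]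
  exact lp.norm_le_of_forall_le hε h

/-- The pointwise reciprocal of `T` as a bounded function; `0` unless it is bounded. -/
noncomputable def invLinf (T : I → ℝ) : lp (fun _ : I => ℝ) ∞ :=
  toLinf fun u => (((T u)⁻¹ : ℝ) : EReal)

/-- The map `z ↦ z ^ 2 / T` on bounded functions, written with the ring structure of `ℓ^∞` so that
its continuity is automatic. -/
noncomputable def sqDiv (T : I → ℝ) (z : lp (fun _ : I => ℝ) ∞) : lp (fun _ : I => ℝ) ∞ :=
  z * z * invLinf T

lemma continuous_sqDiv (T : I → ℝ) : Continuous (sqDiv T) :=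
  (continuous_id.mul continuous_id).mul continuous_const

lemma sqDiv_apply {T : I → ℝ} {c : ℝ} (hc : 0 < c) (hT : ∀ u, c ≤ T u)
    (z : lp (fun _ : I => ℝ) ∞) (u : I) : sqDiv T z u = (z u / √(T u)) ^ 2 := by
  have hb : IsBddPath fun u => (((T u)⁻¹ : ℝ) : EReal) :=
    isBddPath_of_abs_le (C := c⁻¹) fun u => by
      rw [abs_of_pos (inv_pos.2 (hc.trans_le (hT u)))]
      exact inv_anti₀ hc (hT u)
  have h0 : 0 ≤ T u := (hc.trans_le (hT u)).le
  rw [sqDiv, lp.infty_coeFn_mul, Pi.mul_apply, lp.infty_coeFn_mul, Pi.mul_apply, invLinf,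
    toLinf_apply hb, EReal.toReal_coe, div_pow, Real.sq_sqrt h0]
  ring

lemma lipschitzWith_toReal_of_le_add {E : Type*} [PseudoMetricSpace E] {φ : E → ℝ≥0∞}
    (hfin : ∀ z, φ z ≠ ∞) {C : ℝ≥0}
    (h : ∀ z w, φ z ≤ φ w + C * ENNReal.ofReal (dist z w)) :
    LipschitzWith C fun z => (φ z).toReal := by
  refine LipschitzWith.of_le_add_mul C fun z w => ?_
  have := ENNReal.toReal_mono (by finiteness [hfin w]) (h z w)
  rwa [ENNReal.toReal_add (hfin w) (by finiteness), ENNReal.toReal_mul,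
    ENNReal.toReal_ofReal dist_nonneg, ENNReal.coe_toReal] at this

lemma ofReal_apply_le_add_dist (z w : lp (fun _ : I => ℝ) ∞) (u : I) :
    ENNReal.ofReal (z u) ≤ ENNReal.ofReal (w u) + ENNReal.ofReal (dist z w) :=
  (ENNReal.ofReal_le_ofReal (by linarith [(abs_le.1 (abs_sub_le_dist z w u)).2])).trans
    ENNReal.ofReal_add_le

lemma ofReal_apply_le_norm (z : lp (fun _ : I => ℝ) ∞) (u : I) :
    ENNReal.ofReal (z u) ≤ ENNReal.ofReal ‖z‖ :=
  ENNReal.ofReal_le_ofReal ((le_abs_self _).trans (abs_apply_le_norm z u))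

lemma continuous_iSup_ofReal :
    Continuous fun z : lp (fun _ : I => ℝ) ∞ => ⨆ u, ENNReal.ofReal (z u) := by
  have hfin : ∀ z : lp (fun _ : I => ℝ) ∞, ⨆ u, ENNReal.ofReal (z u) ≠ ∞ := fun z =>
    ne_top_of_le_ne_top ENNReal.ofReal_ne_top (iSup_le (ofReal_apply_le_norm z))
  have hL := lipschitzWith_toReal_of_le_add hfin (C := 1) fun z w => by
    rw [ENNReal.coe_one, one_mul]
    exact iSup_le fun u => (ofReal_apply_le_add_dist z w u).trans
      (by gcongr; exact le_iSup (fun u => ENNReal.ofReal (w u)) u)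
  refine (ENNReal.continuous_ofReal.comp hL.continuous).congr fun z => ?_
  exact ENNReal.ofReal_toReal (hfin z)

variable [MeasurableSpace I] (μ : Measure I) [IsFiniteMeasure μ]

lemma lintegral_ofReal_ne_top (z : lp (fun _ : I => ℝ) ∞) :
    ∫⁻ u, ENNReal.ofReal (z u) ∂μ ≠ ∞ := by
  refine ne_top_of_le_ne_top ?_ (lintegral_mono (ofReal_apply_le_norm z))
  rw [lintegral_const]
  finiteness

/-- The lower integral is Lipschitz on `ℓ^∞`, although the paths need not be measurable. -/
lemma continuous_toReal_lintegral_ofReal :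
    Continuous fun z : lp (fun _ : I => ℝ) ∞ => (∫⁻ u, ENNReal.ofReal (z u) ∂μ).toReal := by
  refine (lipschitzWith_toReal_of_le_add (lintegral_ofReal_ne_top μ)
    (C := (μ Set.univ).toNNReal) fun z w => ?_).continuous
  refine (lintegral_mono (ofReal_apply_le_add_dist z w)).trans (le_of_eq ?_)
  rw [lintegral_add_right _ measurable_const, lintegral_const, mul_comm,
    ENNReal.coe_toNNReal (measure_ne_top μ _)]

end BoundedPaths

section Stochastic

variable {Ω Ω' : Type*} [MeasurableSpace Ω] [MeasurableSpace Ω'] {P : Measure Ω}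
  {P' : Measure Ω'}

lemma tendsto_measure_zero_mono {A B : ℕ → Set Ω}
    (hB : Tendsto (fun n => P (B n)) atTop (𝓝 0)) (h : ∀ᶠ n in atTop, A n ⊆ B n) :
    Tendsto (fun n => P (A n)) atTop (𝓝 0) :=
  tendsto_of_tendsto_of_tendsto_of_le_of_le' tendsto_const_nhds hB
    (Eventually.of_forall fun _ => zero_le) (h.mono fun _ hn => measure_mono hn)

lemma tendsto_measure_union_zero {A B : ℕ → Set Ω}
    (hA : Tendsto (fun n => P (A n)) atTop (𝓝 0)) (hB : Tendsto (fun n => P (B n)) atTop (𝓝 0)) :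
    Tendsto (fun n => P (A n ∪ B n)) atTop (𝓝 0) := by
  have := hA.add hB
  rw [add_zero] at this
  exact tendsto_of_tendsto_of_tendsto_of_le_of_le tendsto_const_nhds this
    (fun _ => zero_le) fun _ => measure_union_le _ _

/-- A sequence of events is negligible if, for every `η`, it is contained up to a negligible
sequence in events of probability at most `η`. -/
lemma tendsto_measure_zero_of_forall {A : ℕ → Set Ω}
    (h : ∀ η : ℝ≥0∞, 0 < η → ∃ B C : ℕ → Set Ω, (∀ᶠ n in atTop, P (B n) ≤ η) ∧
      Tendsto (fun n => P (C n)) atTop (𝓝 0) ∧ ∀ᶠ n in atTop, A n ⊆ B n ∪ C n) :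
    Tendsto (fun n => P (A n)) atTop (𝓝 0) := by
  rw [ENNReal.tendsto_nhds_zero]
  intro η hη
  have hη2 : 0 < η / 2 := ENNReal.half_pos hη.ne'
  obtain ⟨B, C, hB, hC, hsub⟩ := h (η / 2) hη2
  filter_upwards [hB, ENNReal.tendsto_nhds_zero.1 hC _ hη2, hsub] with n h1 h2 h3
  calc P (A n) ≤ P (B n) + P (C n) := (measure_mono h3).trans (measure_union_le _ _)
    _ ≤ η / 2 + η / 2 := add_le_add h1 h2
    _ = η := ENNReal.add_halves η

lemma tendsto_innerProb_one {s : ℕ → Set Ω} (h : Tendsto (fun n => P (s n)ᶜ) atTop (𝓝 0)) :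
    Tendsto (fun n => innerProb P (s n)) atTop (𝓝 1) := by
  simpa [innerProb] using ENNReal.Tendsto.sub (tendsto_const_nhds (x := (1 : ℝ≥0∞))) h
    (Or.inl ENNReal.one_ne_top)

lemma IsLittleOP.tendsto_not_forall_abs_le {I : Type*} {x : ℕ → Ω → I → ℝ}
    (h : IsLittleOP P fun n ω => ⨆ u, ‖x n ω u‖ₑ) {δ : ℝ} (hδ : 0 < δ) :
    Tendsto (fun n => P {ω | ¬ ∀ u, |x n ω u| ≤ δ}) atTop (𝓝 0) := by
  refine tendsto_measure_zero_mono (h _ (ENNReal.ofReal_pos.2 hδ)) (Eventually.of_forall ?_)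
  intro n ω hω
  by_contra hle
  refine hω fun u => ?_
  have := (le_iSup (fun u => ‖x n ω u‖ₑ) u).trans (not_lt.1 hle)
  rwa [← ofReal_norm, ENNReal.ofReal_le_ofReal_iff hδ.le, Real.norm_eq_abs] at this

lemma IsLittleOP.tendsto_not_forall_abs_le_mul_sqrt {I : Type*}
    {x : (n : ℕ) → Ω → I → Fin n → ℝ}
    (h : IsLittleOP P fun n ω => (⨆ u, ⨆ i, ‖x n ω u i‖ₑ) / ENNReal.ofReal √(n : ℝ))
    {δ : ℝ} (hδ : 0 < δ) :
    Tendsto (fun n => P {ω | ¬ ∀ u i, |x n ω u i| ≤ δ * √(n : ℝ)}) atTop (𝓝 0) := by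
  refine tendsto_measure_zero_mono (h _ (ENNReal.ofReal_pos.2 hδ)) ?_
  filter_upwards [eventually_gt_atTop 0] with n hn ω hω
  by_contra hle
  refine hω fun u i => ?_
  have hs : 0 < √(n : ℝ) := Real.sqrt_pos.2 (by exact_mod_cast hn)
  have h1 : (⨆ u, ⨆ i, ‖x n ω u i‖ₑ) / ENNReal.ofReal √(n : ℝ) ≤ ENNReal.ofReal δ := not_lt.1 hle
  rw [ENNReal.div_le_iff (ENNReal.ofReal_pos.2 hs).ne' ENNReal.ofReal_ne_top,
    ← ENNReal.ofReal_mul hδ.le] at h1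
  have := (le_iSup₂ (f := fun u i => ‖x n ω u i‖ₑ) u i).trans h1
  rwa [← ofReal_norm, ENNReal.ofReal_le_ofReal_iff (by positivity),
    Real.norm_eq_abs] at this

variable [IsProbabilityMeasure P] [IsProbabilityMeasure P']

/-- If the limit almost surely leaves a decreasing sequence of closed sets, the sequence is
asymptotically unlikely to be in a late one. -/
lemma WeakConv.exists_eventually_measure_le {E : Type*} [PseudoMetricSpace E]
    {Z : ℕ → Ω → E} {Z' : Ω' → E} (h : WeakConv P P' Z Z') {F : ℕ → Set E}
    (hF : ∀ m, IsClosed (F m)) (hanti : Antitone F) (h0 : P' (⋂ m, Z' ⁻¹' F m) = 0)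
    {η : ℝ≥0∞} (hη : 0 < η) :
    ∃ m, ∀ᶠ n in atTop, P {ω | Z n ω ∈ F m} ≤ η := by
  let : MeasurableSpace E := borel E
  have : BorelSpace E := ⟨rfl⟩
  have hm : Measurable Z' := h.1
  have hlim : Tendsto (fun m => P' (Z' ⁻¹' F m)) atTop (𝓝 (P' (⋂ m, Z' ⁻¹' F m))) :=
    tendsto_measure_iInter_atTop (fun m => (hm (hF m).measurableSet).nullMeasurableSet)
      (fun i j hij => Set.preimage_mono (hanti hij)) ⟨0, measure_ne_top _ _⟩
  rw [h0] at hlim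
  have hη2 : 0 < η / 2 := ENNReal.half_pos hη.ne'
  obtain ⟨m, hm⟩ := (ENNReal.tendsto_nhds_zero.1 hlim _ hη2).exists
  refine ⟨m, (h.eventually_measure_closed_le (hF m) hη2).mono fun n hn => hn.trans ?_⟩
  calc P' (Z' ⁻¹' F m) + η / 2 ≤ η / 2 + η / 2 := by gcongr
    _ = η := ENNReal.add_halves η

/-- A weakly convergent sequence in a normed space is asymptotically bounded in probability. -/
lemma WeakConv.exists_eventually_measure_norm_le {E : Type*} [SeminormedAddCommGroup E]
    {Z : ℕ → Ω → E} {Z' : Ω' → E} (h : WeakConv P P' Z Z') {η : ℝ≥0∞} (hη : 0 < η) :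
    ∃ K : ℝ, 0 < K ∧ ∀ᶠ n in atTop, P {ω | K ≤ ‖Z n ω‖} ≤ η := by
  obtain ⟨m, hm⟩ := h.exists_eventually_measure_le (F := fun m : ℕ => {z : E | (m : ℝ) + 1 ≤ ‖z‖})
    (fun m => isClosed_le continuous_const continuous_norm)
    (fun i j hij z hz => by
      have hz' : (j : ℝ) + 1 ≤ ‖z‖ := hz
      have : (i : ℝ) ≤ j := Nat.cast_le.2 hij
      show (i : ℝ) + 1 ≤ ‖z‖
      linarith) (by
      convert measure_empty (μ := P')
      refine Set.eq_empty_of_forall_notMem fun ω' hω' => ?_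
      obtain ⟨m, hm⟩ := exists_nat_gt ‖Z' ω'‖
      have h1 : (m : ℝ) + 1 ≤ ‖Z' ω'‖ := Set.mem_iInter.1 hω' m
      linarith) hη
  exact ⟨m + 1, by positivity, hm⟩

end Stochastic

/-! ### Approximation of the statistics -/

section IntegralStatistic

variable {k : ℕ} {U : Set (Fin k → ℝ)} {μ ν : Measure U}

lemma abs_measureReal_univ_sub_le [IsFiniteMeasure μ] [IsFiniteMeasure ν] {δ : ℝ}
    (hδ : ∀ x, |distFun ν x - distFun μ x| ≤ δ) :
    |ν.real Set.univ - μ.real Set.univ| ≤ 2 ^ k * δ := by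
  have h := abs_measureReal_box_sub_le hδ (B := fun _ => Set.univ) fun _ => Set.ordConnected_univ
  have hU : boxTrace U (fun _ => Set.univ) = Set.univ := by ext; simp [boxTrace]
  rwa [hU] at h

/-- If `l` is uniformly close to `z`, `z` has a box cover for `μ`, and the distribution functions of
`ν` and `μ` are close, then so are the lower integrals `∫ l dν` and `∫ z dμ`. -/
lemma exists_lintegral_close (μ : Measure U) [IsFiniteMeasure μ] {M ε₀ : ℝ} (hM : 0 ≤ M)
    (hε₀ : 0 < ε₀) :
    ∃ ε : ℝ, 0 < ε ∧ ∀ N : ℕ, ∃ δ : ℝ, 0 < δ ∧ ∀ (ν : Measure U) [IsFiniteMeasure ν]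
      (z : U → ℝ) (l : U → ℝ≥0∞), (∀ u, 0 ≤ z u) → (∀ u, z u ≤ M) →
      HasBoxCover μ N (3 * ε) z → (∀ x, |distFun ν x - distFun μ x| ≤ δ) →
      (∀ u, l u ≠ ∞ ∧ |(l u).toReal - z u| ≤ ε) →
      ∫⁻ u, l u ∂ν ≠ ∞ ∧
        |(∫⁻ u, l u ∂ν).toReal - (∫⁻ u, ENNReal.ofReal (z u) ∂μ).toReal| ≤ ε₀ := by
  set m₀ : ℝ := μ.real Set.univ with hm₀
  have hm₀0 : 0 ≤ m₀ := measureReal_nonneg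
  -- `ε` accounts for half of the error, through the total masses (at most `m₀ + 1`), the
  -- oscillation and the bad boxes; `δ`, chosen after `N`, makes the differences on the atoms take
  -- the other half
  set ε : ℝ := ε₀ / (2 * (4 * (m₀ + 1) + 3 * M)) with hε
  have hε0 : 0 < ε := by positivity
  have hεe : ε * (4 * (m₀ + 1) + 3 * M) = ε₀ / 2 := by rw [hε]; field_simp
  refine ⟨ε, hε0, fun N => ?_⟩
  set q : ℝ := M * N * (2 ^ N * 2 ^ k) with hq
  have hq0 : 0 ≤ q := by positivity
  refine ⟨min (1 / 2 ^ k) (ε₀ / (4 * (q + 1))), by positivity, ?_⟩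
  set δ : ℝ := min (1 / 2 ^ k) (ε₀ / (4 * (q + 1))) with hδdef
  have hδ0 : 0 < δ := by positivity
  have hδ1 : 2 ^ k * δ ≤ 1 := by
    have : δ ≤ 1 / 2 ^ k := min_le_left _ _
    rwa [le_div_iff₀ (by positivity), mul_comm] at this
  have hδ2 : 2 * (q * δ) ≤ ε₀ / 2 := by
    have : δ ≤ ε₀ / (4 * (q + 1)) := min_le_right _ _
    rw [le_div_iff₀ (by positivity)] at this
    nlinarith
  clear_value δ ε q m₀
  intro ν _ z l hz0 hzM hcov hδ hl
  have hνu : ν.real Set.univ ≤ m₀ + 1 := by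
    have := (abs_le.1 (abs_measureReal_univ_sub_le hδ)).2
    rw [← hm₀] at this
    linarith
  have hν0 : 0 ≤ ν.real Set.univ := measureReal_nonneg
  obtain ⟨h1, h2⟩ := lintegral_le_of_hasBoxCover (ν := ν) (by positivity) hM hzM hcov hδ
  have hfinμ : ∫⁻ u, ENNReal.ofReal (z u) ∂μ ≠ ∞ := by
    refine ne_top_of_le_ne_top ?_ (lintegral_mono fun u => ENNReal.ofReal_le_ofReal (hzM u))
    rw [lintegral_const]
    finiteness
  have hup : ∫⁻ u, l u ∂ν ≤ ∫⁻ u, ENNReal.ofReal (z u) ∂ν +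
      ENNReal.ofReal (ε * ν.real Set.univ) := by
    calc ∫⁻ u, l u ∂ν ≤ ∫⁻ u, (ENNReal.ofReal (z u) + ENNReal.ofReal ε) ∂ν := by
          refine lintegral_mono fun u => ?_
          rw [← ENNReal.ofReal_add (hz0 u) hε0.le]
          refine ENNReal.le_ofReal_iff_toReal_le (hl u).1 (by linarith [hz0 u]) |>.2 ?_
          linarith [(abs_le.1 (hl u).2).2]
      _ = _ := by
          rw [lintegral_add_right _ measurable_const, lintegral_const,
            ENNReal.ofReal_mul hε0.le, ofReal_measureReal]
  have hlo : ∫⁻ u, ENNReal.ofReal (z u) ∂ν ≤ ∫⁻ u, l u ∂ν +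
      ENNReal.ofReal (ε * ν.real Set.univ) := by
    calc ∫⁻ u, ENNReal.ofReal (z u) ∂ν ≤ ∫⁻ u, (l u + ENNReal.ofReal ε) ∂ν := by
          refine lintegral_mono fun u => ?_
          conv_rhs => rw [← ENNReal.ofReal_toReal (hl u).1]
          rw [← ENNReal.ofReal_add ENNReal.toReal_nonneg hε0.le]
          exact ENNReal.ofReal_le_ofReal (by linarith [(abs_le.1 (hl u).2).1])
      _ = _ := by
          rw [lintegral_add_right _ measurable_const, lintegral_const,
            ENNReal.ofReal_mul hε0.le, ofReal_measureReal]
  have hfinν : ∫⁻ u, l u ∂ν ≠ ∞ :=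
    ne_top_of_le_ne_top (by finiteness) (hup.trans (add_le_add_left h1 _))
  refine ⟨hfinν, ?_⟩
  have e1 := ENNReal.toReal_mono (by finiteness) (hup.trans (add_le_add_left h1 _))
  have e2 := ENNReal.toReal_mono (by finiteness) (h2.trans (add_le_add_left hlo _))
  have hprod : N * (M * (2 ^ N * (2 ^ k * δ))) = q * δ := by rw [hq]; ring
  have hprod' : M * (3 * ε + N * (2 ^ N * (2 ^ k * δ))) = 3 * ε * M + q * δ := by rw [hq]; ring
  rw [ENNReal.toReal_add (by finiteness) (by finiteness),
    ENNReal.toReal_add (by finiteness) (by finiteness), ENNReal.toReal_ofReal (by positivity),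
    ENNReal.toReal_ofReal (by positivity), hprod] at e1
  rw [ENNReal.toReal_add (by finiteness) (by finiteness),
    ENNReal.toReal_add (by finiteness) (by finiteness), ENNReal.toReal_ofReal (by positivity),
    ENNReal.toReal_ofReal (by positivity), hprod, hprod'] at e2
  rw [← hm₀] at e1
  have b1 : ε * ν.real Set.univ ≤ ε * (m₀ + 1) := by gcongr
  have b2 : ε * m₀ ≤ ε * (m₀ + 1) := by gcongr; linarith
  have b3 : 0 ≤ q * δ := by positivity
  have hεe' : 4 * (ε * (m₀ + 1)) + 3 * (ε * M) = ε₀ / 2 := by rw [← hεe]; ring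
  rw [abs_le]
  constructor
  · nlinarith only [e2, b1, b2, hδ2, hεe', b3]
  · nlinarith only [e1, b1, b2, hδ2, hεe', b3]

variable {Ω Ω' : Type*} [MeasurableSpace Ω] [MeasurableSpace Ω'] {P : Measure Ω}
  {P' : Measure Ω'} [IsProbabilityMeasure P] [IsProbabilityMeasure P']

/-- The functions near one with a box cover form an open set, so the weak limit, if almost surely
box-Riemann, transfers box covers with a bounded number of boxes to the sequence. -/
lemma WeakConv.exists_eventually_hasBoxCover {Z : ℕ → Ω → lp (fun _ : U => ℝ) ∞}
    {Z' : Ω' → lp (fun _ : U => ℝ) ∞} (h : WeakConv P P' Z Z')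
    (hR : ∀ᵐ ω' ∂P', IsBoxRiemann μ fun u => Z' ω' u) {ε : ℝ} (hε : 0 < ε) {η : ℝ≥0∞}
    (hη : 0 < η) :
    ∃ N, ∀ᶠ n in atTop, P {ω | ¬ HasBoxCover μ N (3 * ε) fun u => Z n ω u} ≤ η := by
  set O : ℕ → Set (lp (fun _ : U => ℝ) ∞) := fun N =>
    ⋃ w ∈ {w : lp (fun _ : U => ℝ) ∞ | HasBoxCover μ N ε fun u => w u}, Metric.ball w ε with hO
  have hopen : ∀ N, IsOpen (O N) := fun N => isOpen_biUnion fun _ _ => Metric.isOpen_ball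
  have hmono : Monotone O := by
    intro N N' hN
    refine Set.biUnion_subset_biUnion_left ?_
    rintro w ⟨m, B, hm, h⟩
    exact ⟨m, B, hm.trans hN, h⟩
  obtain ⟨N, hN⟩ := h.exists_eventually_measure_le (F := fun N => (O N)ᶜ)
    (fun N => (hopen N).isClosed_compl) (fun i j hij => Set.compl_subset_compl.2 (hmono hij))
    (by
      refine measure_mono_null (fun ω' hω' => ?_) (ae_iff.1 hR)
      intro hbr
      obtain ⟨N, B, hB, hcov, hbad⟩ := hbr ε hε
      refine Set.mem_iInter.1 hω' N (Set.mem_biUnion (x := Z' ω') ?_ (Metric.mem_ball_self hε))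
      exact ⟨N, B, le_rfl, hB, hcov, hbad⟩) hη
  refine ⟨N, hN.mono fun n hn => (measure_mono fun ω hω => ?_).trans hn⟩
  intro hmem
  obtain ⟨w, hw, hd⟩ := Set.mem_iUnion₂.1 hmem
  exact hω (HasBoxCover.of_abs_sub_le hε hw fun u =>
    (abs_sub_le_dist _ _ u).trans (Metric.mem_ball.1 hd).le)

end IntegralStatistic

namespace TestSetup

variable {Ω S : Type*} {d p k : ℕ} {U : Set (Fin k → ℝ)} (D : TestSetup Ω S d p U)

lemma isBddPath_ell_of_close {n : ℕ} {ω : Ω} {z : lp (fun _ : U => ℝ) ∞} {ε : ℝ}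
    (h : ∀ u, D.ell n ω u ≠ ∞ ∧ |(D.ell n ω u).toReal - z u| ≤ ε) :
    IsBddPath fun u => (D.ell n ω u : EReal) := by
  have hcoe : (fun u => (D.ell n ω u : EReal)) = fun u => ((D.ell n ω u).toReal : EReal) := by
    funext u
    exact (EReal.coe_ennreal_toReal (h u).1).symm
  rw [hcoe]
  refine isBddPath_of_abs_le (C := ‖z‖ + ε) fun u => ?_
  have h1 := abs_le.1 (abs_apply_le_norm z u)
  have h2 := abs_le.1 (h u).2
  rw [abs_le]
  constructor <;> linarith [h1.1, h1.2, h2.1, h2.2]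

variable [MeasurableSpace Ω] {P : Measure Ω}

section Null

variable {Ω' : Type*} [MeasurableSpace Ω'] {P' : Measure Ω'}
  [IsProbabilityMeasure P] [IsProbabilityMeasure P'] {V : Ω' → U → ℝ} {T : U → ℝ}

/-- Uniformly in `u`, the log likelihood ratio is close to `R ^ 2 / T`. -/
lemma tendsto_ell_sub_sq (hR : WeakConvLinf P P' (fun n ω u => (D.R n ω u : EReal)) V)
    (h2 : D.C2 P T) (h3 : D.C3 P) {ε : ℝ} (hε : 0 < ε) :
    Tendsto (fun n => P {ω | ¬ ∀ u, D.ell n ω u ≠ ∞ ∧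
      |(D.ell n ω u).toReal - sqDiv T (toLinf fun u => (D.R n ω u : EReal)) u| ≤ ε})
      atTop (𝓝 0) := by
  obtain ⟨c, hc, hcT⟩ := h2.lower
  refine tendsto_measure_zero_of_forall fun η hη => ?_
  obtain ⟨K, hK, htight⟩ := hR.2.2.exists_eventually_measure_norm_le hη
  obtain ⟨δ, hδ, happrox⟩ := exists_negTwoLogEL_approx hK hc hε
  refine ⟨_, _, htight, tendsto_measure_union_zero hR.1 (tendsto_measure_union_zero
    (h2.conv.tendsto_not_forall_abs_le hδ) (h3.tendsto_not_forall_abs_le_mul_sqrt hδ)), ?_⟩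
  filter_upwards [eventually_gt_atTop 0] with n hn ω hω
  by_contra hcon
  simp only [Set.mem_union, Set.mem_ofPred_eq, not_or, not_not, not_le] at hcon
  obtain ⟨hnorm, hb, hS, hA⟩ := hcon
  refine hω fun u => ?_
  have hRu : toLinf (fun u => (D.R n ω u : EReal)) u = D.R n ω u := by
    rw [toLinf_apply hb, EReal.toReal_coe]
  have hT0 : 0 ≤ T u := hc.le.trans (hcT u)
  rw [sqDiv_apply hc hcT, hRu, div_pow, Real.sq_sqrt hT0]
  refine happrox n hn (D.A n ω u) (T u) (hcT u) ?_ (hS u) (hA u)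
  have := (abs_apply_le_norm (toLinf fun u => (D.R n ω u : EReal)) u).trans hnorm.le
  rwa [hRu] at this

end Null
/-! ### Limits under the null hypothesis and under alternatives -/

section NullLimits

variable {Ω' : Type*} [MeasurableSpace Ω'] {P' : Measure Ω'}
  {V : Ω' → U → ℝ} {T : U → ℝ}

lemma isBddPath_sq_div {c : ℝ} (hc : 0 < c) (hT : ∀ u, c ≤ T u) {v : U → ℝ}
    (hv : IsBddPath fun u => (v u : EReal)) :
    IsBddPath fun u => (((v u / √(T u)) ^ 2 : ℝ) : EReal) := by
  refine isBddPath_of_abs_le (C := ‖sqDiv T (toLinf fun u => (v u : EReal))‖) fun u => ?_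
  have := abs_apply_le_norm (sqDiv T (toLinf fun u => (v u : EReal))) u
  rwa [sqDiv_apply hc hT, toLinf_apply hv, EReal.toReal_coe] at this

lemma sqDiv_toLinf {c : ℝ} (hc : 0 < c) (hT : ∀ u, c ≤ T u) {v : U → ℝ}
    (hv : IsBddPath fun u => (v u : EReal)) :
    sqDiv T (toLinf fun u => (v u : EReal)) =
      toLinf fun u => (((v u / √(T u)) ^ 2 : ℝ) : EReal) := by
  refine lp.ext (funext fun u => ?_)
  rw [sqDiv_apply hc hT, toLinf_apply hv, EReal.toReal_coe,
    toLinf_apply (isBddPath_sq_div hc hT hv), EReal.toReal_coe]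

/-- The limit of the squared and standardized marked empirical process. -/
lemma weakConv_sqDiv (hR : WeakConvLinf P P' (fun n ω u => (D.R n ω u : EReal)) V)
    (h2 : D.C2 P T) :
    WeakConv P P' (fun n ω => sqDiv T (toLinf fun u => (D.R n ω u : EReal)))
      (fun ω' => toLinf fun u => (((V ω' u / √(T u)) ^ 2 : ℝ) : EReal)) := by
  obtain ⟨c, hc, hcT⟩ := h2.lower
  have h := hR.2.2.comp (continuous_sqDiv T)
  have he : (fun ω' => sqDiv T (toLinf fun u => (V ω' u : EReal))) =
      fun ω' => toLinf fun u => (((V ω' u / √(T u)) ^ 2 : ℝ) : EReal) :=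
    funext fun ω' => sqDiv_toLinf hc hcT (hR.2.1 ω')
  rwa [he] at h

variable [IsProbabilityMeasure P] [IsProbabilityMeasure P']

theorem weakConvLinf_ell (hR : WeakConvLinf P P' (fun n ω u => (D.R n ω u : EReal)) V)
    (h2 : D.C2 P T) (h3 : D.C3 P) :
    WeakConvLinf P P' (fun n ω u => (D.ell n ω u : EReal))
      (fun ω' u => (V ω' u / √(T u)) ^ 2) := by
  obtain ⟨c, hc, hcT⟩ := h2.lower
  refine ⟨?_, fun ω' => isBddPath_sq_div hc hcT (hR.2.1 ω'), ?_⟩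
  · refine tendsto_measure_zero_mono (D.tendsto_ell_sub_sq hR h2 h3 one_pos)
      (Eventually.of_forall fun n ω hω hclose => hω (D.isBddPath_ell_of_close hclose))
  · refine (D.weakConv_sqDiv hR h2).of_dist fun ε hε => ?_
    refine tendsto_measure_zero_mono (D.tendsto_ell_sub_sq hR h2 h3 hε)
      (Eventually.of_forall fun n ω hω hclose => ?_)
    refine not_le.2 hω (dist_le_of_forall_abs_sub_le hε.le fun u => ?_)
    rw [toLinf_apply (D.isBddPath_ell_of_close hclose), EReal.toReal_coe_ennreal]
    exact (hclose u).2

theorem weakConv_supStat (hR : WeakConvLinf P P' (fun n ω u => (D.R n ω u : EReal)) V)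
    (h2 : D.C2 P T) (h3 : D.C3 P) :
    WeakConv P P' D.supStat (fun ω' => ⨆ u, ENNReal.ofReal ((V ω' u / √(T u)) ^ 2)) := by
  have hell := D.weakConvLinf_ell hR h2 h3
  have h := hell.2.2.comp continuous_iSup_ofReal
  have he : (fun ω' => ⨆ u, ENNReal.ofReal
      (toLinf (fun u => (((V ω' u / √(T u)) ^ 2 : ℝ) : EReal)) u)) =
      fun ω' => ⨆ u, ENNReal.ofReal ((V ω' u / √(T u)) ^ 2) := by
    funext ω'
    refine iSup_congr fun u => ?_
    rw [toLinf_apply (hell.2.1 ω'), EReal.toReal_coe]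
  rw [he] at h
  refine h.congr (tendsto_measure_zero_mono (D.tendsto_ell_sub_sq hR h2 h3 one_pos)
    (Eventually.of_forall fun n ω hω hclose => hω (iSup_congr fun u => ?_)))
  rw [toLinf_apply (D.isBddPath_ell_of_close hclose), EReal.toReal_coe_ennreal,
    ENNReal.ofReal_toReal (hclose u).1]

/-- With probability tending to one the integral statistic is finite and close to the lower
integral of `R ^ 2 / T` with respect to `μ`. -/
lemma tendsto_intStat_sub (hR : WeakConvLinf P P' (fun n ω u => (D.R n ω u : EReal)) V)
    (h2 : D.C2 P T) (h3 : D.C3 P) {μ : Measure U} [IsFiniteMeasure μ]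
    {μn : ℕ → Ω → Measure U} [∀ n ω, IsFiniteMeasure (μn n ω)]
    (hμ : IsLittleOP P (fun n ω => ⨆ x : Fin k → ℝ, ‖distFun (μn n ω) x - distFun μ x‖ₑ))
    (hbr : ∀ᵐ ω' ∂P', IsBoxRiemann μ (fun u => (V ω' u / √(T u)) ^ 2)) {ε₀ : ℝ} (hε₀ : 0 < ε₀) :
    Tendsto (fun n => P {ω | ¬ (D.intStat μn n ω ≠ ∞ ∧ |(D.intStat μn n ω).toReal -
      (∫⁻ u, ENNReal.ofReal (sqDiv T (toLinf fun u => (D.R n ω u : EReal)) u) ∂μ).toReal| ≤ ε₀)})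
      atTop (𝓝 0) := by
  obtain ⟨c, hc, hcT⟩ := h2.lower
  have hZ := D.weakConv_sqDiv hR h2
  refine tendsto_measure_zero_of_forall fun η hη => ?_
  have hη2 : 0 < η / 2 := ENNReal.half_pos hη.ne'
  obtain ⟨M, hM, htight⟩ := hZ.exists_eventually_measure_norm_le hη2
  obtain ⟨ε, hε, hN⟩ := exists_lintegral_close μ hM.le hε₀
  obtain ⟨N, hcov⟩ := hZ.exists_eventually_hasBoxCover (μ := μ) (hbr.mono fun ω' h => by
    have he : (fun u => toLinf (fun u => (((V ω' u / √(T u)) ^ 2 : ℝ) : EReal)) u) =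
        fun u => (V ω' u / √(T u)) ^ 2 := by
      funext u
      rw [toLinf_apply (isBddPath_sq_div hc hcT (hR.2.1 ω')), EReal.toReal_coe]
    rwa [he]) hε hη2
  obtain ⟨δ, hδ, hclose⟩ := hN N
  refine ⟨fun n => {ω | M ≤ ‖sqDiv T (toLinf fun u => (D.R n ω u : EReal))‖} ∪
    {ω | ¬ HasBoxCover μ N (3 * ε) fun u => sqDiv T (toLinf fun u => (D.R n ω u : EReal)) u},
    _, ?_, tendsto_measure_union_zero
    (hμ.tendsto_not_forall_abs_le hδ) (D.tendsto_ell_sub_sq hR h2 h3 hε), ?_⟩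
  · filter_upwards [htight, hcov] with n h1 h2
    exact (measure_union_le _ _).trans ((add_le_add h1 h2).trans (ENNReal.add_halves η).le)
  · refine Eventually.of_forall fun n ω hω => ?_
    by_contra hcon
    simp only [Set.mem_union, Set.mem_ofPred_eq, not_or, not_not, not_le] at hcon
    obtain ⟨⟨hnorm, hB⟩, hdist, hell⟩ := hcon
    refine hω (hclose (μn n ω) _ (D.ell n ω) (fun u => ?_) (fun u => ?_) hB hdist hell)
    · rw [sqDiv_apply hc hcT]; positivity
    · exact (le_abs_self _).trans ((abs_apply_le_norm _ u).trans hnorm.le)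

theorem weakConv_intStat (hR : WeakConvLinf P P' (fun n ω u => (D.R n ω u : EReal)) V)
    (h2 : D.C2 P T) (h3 : D.C3 P) {μ : Measure U} [IsFiniteMeasure μ]
    {μn : ℕ → Ω → Measure U} [∀ n ω, IsFiniteMeasure (μn n ω)]
    (hμ : IsLittleOP P (fun n ω => ⨆ x : Fin k → ℝ, ‖distFun (μn n ω) x - distFun μ x‖ₑ))
    (hbr : ∀ᵐ ω' ∂P', IsBoxRiemann μ (fun u => (V ω' u / √(T u)) ^ 2)) :
    WeakConv P P' (D.intStat μn)
      (fun ω' => ∫⁻ u, ENNReal.ofReal ((V ω' u / √(T u)) ^ 2) ∂μ) := by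
  obtain ⟨c, hc, hcT⟩ := h2.lower
  have h := (D.weakConv_sqDiv hR h2).comp (continuous_toReal_lintegral_ofReal μ)
  -- Slutsky's lemma is stated for a metric, so it is applied to real values first
  have hreal : WeakConv P P' (fun n ω => (D.intStat μn n ω).toReal) _ := h.of_dist fun ε hε =>
    tendsto_measure_zero_mono (D.tendsto_intStat_sub hR h2 h3 hμ hbr hε)
      (Eventually.of_forall fun n ω hω hclose => not_le.2 hω hclose.2)
  have hE := hreal.comp ENNReal.continuous_ofReal
  have he : (fun ω' => ENNReal.ofReal (∫⁻ u, ENNReal.ofReal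
      (toLinf (fun u => (((V ω' u / √(T u)) ^ 2 : ℝ) : EReal)) u) ∂μ).toReal) =
      fun ω' => ∫⁻ u, ENNReal.ofReal ((V ω' u / √(T u)) ^ 2) ∂μ := by
    funext ω'
    rw [ENNReal.ofReal_toReal (lintegral_ofReal_ne_top μ _)]
    refine lintegral_congr fun u => ?_
    rw [toLinf_apply (isBddPath_sq_div hc hcT (hR.2.1 ω')), EReal.toReal_coe]
  rw [he] at hE
  exact hE.congr (tendsto_measure_zero_mono (D.tendsto_intStat_sub hR h2 h3 hμ hbr one_pos)
    (Eventually.of_forall fun n ω hω hclose => hω (ENNReal.ofReal_toReal hclose.1).symm))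

end NullLimits

section Alternative

/-- The infimum occurs inverted in `[0, ∞]`, where `0⁻¹ = ∞` and `s * ∞ = ∞`, so that a finite bound
excludes zeros of `r` on `I₀`. -/
lemma le_mul_abs_of_mul_inv_iInf_le {I : Type*} {I₀ : Set I} {r : I → ℝ} {s : ℝ} (hs : 0 < s)
    {M : ℝ≥0} (h : ENNReal.ofReal s * (⨅ u ∈ I₀, ‖r u‖ₑ)⁻¹ ≤ M) : ∀ u ∈ I₀, s ≤ M * |r u| := by
  intro u hu
  have h1 : ENNReal.ofReal s / ‖r u‖ₑ ≤ M := by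
    rw [div_eq_mul_inv]
    refine le_trans ?_ h
    gcongr
    exact iInf₂_le u hu
  have hr : ‖r u‖ₑ ≠ 0 := by
    intro h0
    rw [h0, ENNReal.div_zero (ENNReal.ofReal_pos.2 hs).ne'] at h1
    exact ENNReal.coe_ne_top (top_le_iff.1 h1)
  rw [ENNReal.div_le_iff hr enorm_ne_top, ← ofReal_norm, Real.norm_eq_abs,
    ← ENNReal.ofReal_coe_nnreal, ← ENNReal.ofReal_mul M.coe_nonneg] at h1
  exact (ENNReal.ofReal_le_ofReal_iff (by positivity)).1 h1

/-- Divergence of `-2 log EL` for a sample whose mean stays away from zero.  With `q = n ^ (1/4)`,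
the dual point `± 1 / (2 q)` gives a bound of order `q ^ 3 = n ^ (3/4)` against an error of order
`q ^ 2`. -/
lemma ofReal_le_negTwoLogEL_of_mean {n : ℕ} {a : Fin n → ℝ} {M B c : ℝ} (hM : 0 < M) (hc : 0 ≤ c)
    (hn : 1 ≤ n) (hq : M * (B + c) ≤ √√(n : ℝ)) (hR : √(n : ℝ) ≤ M * |(√(n : ℝ))⁻¹ * ∑ i, a i|)
    (hS : (n : ℝ)⁻¹ * ∑ i, a i ^ 2 ≤ B) (ha : ∀ i, |a i ^ 2| ≤ 1 * √(n : ℝ)) :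
    ENNReal.ofReal c ≤ negTwoLogEL a := by
  have hn1 : (1 : ℝ) ≤ n := by exact_mod_cast hn
  have hn0 : (0 : ℝ) < n := by linarith
  set r : ℝ := √(n : ℝ) with hr
  set q : ℝ := √r with hqdef
  have hr1 : 1 ≤ r := Real.one_le_sqrt.2 hn1
  have hq1 : 1 ≤ q := Real.one_le_sqrt.2 hr1
  have hq0 : 0 < q := by linarith
  have hqr : q ^ 2 = r := Real.sq_sqrt (by linarith)
  have hrn : r ^ 2 = n := Real.sq_sqrt hn0.le
  have hqn : (n : ℝ) = q ^ 4 := by rw [← hrn, ← hqr]; ring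
  have haq : ∀ i, |a i| ≤ q := fun i => by
    refine abs_le_of_sq_le_sq ?_ hq0.le
    rw [hqr]
    simpa using (le_abs_self _).trans (ha i)
  set s : ℝ := ∑ i, a i with hs
  have hsum : q ^ 4 / M ≤ |s| := by
    rw [abs_mul, abs_of_pos (by positivity), ← hqr] at hR
    rw [div_le_iff₀ hM]
    have : q ^ 2 * q ^ 2 ≤ q ^ 2 * (M * ((q ^ 2)⁻¹ * |s|)) := by gcongr
    calc q ^ 4 = q ^ 2 * q ^ 2 := by ring
      _ ≤ _ := this
      _ = |s| * M := by field_simp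
  have hsq : ∑ i, a i ^ 2 ≤ q ^ 4 * B := by
    rwa [inv_mul_le_iff₀ hn0, hqn] at hS
  obtain ⟨σ, hσ, hσs⟩ : ∃ σ : ℝ, |σ| = 1 ∧ σ * s = |s| := by
    rcases le_total 0 s with h | h
    · exact ⟨1, by simp, by rw [abs_of_nonneg h, one_mul]⟩
    · exact ⟨-1, by simp, by rw [abs_of_nonpos h]; ring⟩
  have hσ2 : σ ^ 2 = 1 := by rw [← sq_abs, hσ, one_pow]
  refine le_trans (ENNReal.ofReal_le_ofReal ?_)
    (negTwoLogEL_ge (a := a) hn (t := σ / (2 * q)) (ρ := 1 / 2) le_rfl fun i => ?_)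
  · have e1 : 2 * (σ / (2 * q) * s) = |s| / q := by rw [← hσs]; field_simp
    have e2 : (σ / (2 * q)) ^ 2 = 1 / (4 * q ^ 2) := by rw [div_pow, hσ2]; ring
    rw [e1, e2]
    have b1 : q ^ 2 * (B + c) ≤ |s| / q := by
      rw [le_div_iff₀ hq0]
      calc q ^ 2 * (B + c) * q = q ^ 3 * (M * (B + c)) / M := by field_simp
        _ ≤ q ^ 3 * q / M := by gcongr
        _ = q ^ 4 / M := by ring
        _ ≤ |s| := hsum
    have b2 : 1 / (4 * q ^ 2) * ∑ i, a i ^ 2 ≤ q ^ 2 * B / 4 := by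
      rw [div_mul_eq_mul_div, div_le_iff₀ (by positivity)]
      calc 1 * ∑ i, a i ^ 2 ≤ q ^ 4 * B := by rw [one_mul]; exact hsq
        _ = _ := by ring
    have hB0 : 0 ≤ B := le_trans (by positivity) hS
    have b3 : c ≤ q ^ 2 * c := le_mul_of_one_le_left hc (one_le_pow₀ hq1)
    have b4 : 0 ≤ q ^ 2 * B := by positivity
    nlinarith only [b1, b2, b3, b4]
  · rw [abs_mul, abs_div, hσ, abs_of_pos (by positivity : 0 < 2 * q), div_mul_eq_mul_div, one_mul,
      div_le_iff₀ (by positivity)]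
    linarith [haq i]

variable {T : U → ℝ} {U₀ : Set U}

/-- On `U₀` the log likelihood ratio exceeds every bound, uniformly, with probability tending to
one. -/
lemma tendsto_not_forall_le_ell (h2 : D.C2 P T) (h1 : D.C1' P U₀) (h3 : D.C3' P) {c : ℝ}
    (hc : 0 ≤ c) :
    Tendsto (fun n => P {ω | ¬ ∀ u ∈ U₀, ENNReal.ofReal c ≤ D.ell n ω u}) atTop (𝓝 0) := by
  obtain ⟨B, hB⟩ := h2.upper
  refine tendsto_measure_zero_of_forall fun η hη => ?_
  obtain ⟨M, hM⟩ := h1 η hη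
  refine ⟨_, _, hM, tendsto_measure_union_zero (h2.conv.tendsto_not_forall_abs_le one_pos)
    (IsLittleOP.tendsto_not_forall_abs_le_mul_sqrt h3 one_pos), ?_⟩
  have hqlim : Tendsto (fun n : ℕ => √√(n : ℝ)) atTop atTop :=
    Real.tendsto_sqrt_atTop.comp (Real.tendsto_sqrt_atTop.comp tendsto_natCast_atTop_atTop)
  filter_upwards [eventually_ge_atTop 1,
    hqlim.eventually_ge_atTop (((M : ℝ) + 1) * (B + 1 + c))] with n hn hq ω hω
  by_contra hcon
  simp only [Set.mem_union, Set.mem_ofPred_eq, not_or, not_not, not_lt] at hcon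
  obtain ⟨hR, hS, hA⟩ := hcon
  refine hω fun u hu => ?_
  have hs : 0 < √(n : ℝ) := Real.sqrt_pos.2 (by exact_mod_cast hn)
  refine ofReal_le_negTwoLogEL_of_mean (a := D.A n ω u) (M := M + 1) (B := B + 1)
    (by positivity) hc hn hq ?_ ?_ (hA u)
  · refine (le_mul_abs_of_mul_inv_iInf_le hs hR u hu).trans ?_
    show (M : ℝ) * |D.R n ω u| ≤ (M + 1) * |D.R n ω u|
    gcongr
    linarith
  · linarith [(abs_le.1 (hS u)).2, hB u]

theorem tendsto_innerProb_supStat (h2 : D.C2 P T) (h1 : D.C1' P U₀) (h3 : D.C3' P)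
    (hne : U₀.Nonempty) {c : ℝ} (hc : 0 < c) :
    Tendsto (fun n => innerProb P {ω | ENNReal.ofReal c < D.supStat n ω}) atTop (𝓝 1) := by
  obtain ⟨u, hu⟩ := hne
  refine tendsto_innerProb_one (tendsto_measure_zero_mono
    (D.tendsto_not_forall_le_ell h2 h1 h3 (c := c + 1) (by positivity))
    (Eventually.of_forall fun n ω hω hall => hω ?_))
  calc ENNReal.ofReal c < ENNReal.ofReal (c + 1) :=
        (ENNReal.ofReal_lt_ofReal_iff (by positivity)).2 (by linarith)
    _ ≤ D.ell n ω u := hall u hu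
    _ ≤ D.supStat n ω := le_iSup (D.ell n ω) u

theorem tendsto_innerProb_intStat (h2 : D.C2 P T) (h1 : D.C1' P U₀) (h3 : D.C3' P)
    {μ : Measure U} [IsFiniteMeasure μ]
    {μn : ℕ → Ω → Measure U} [∀ n ω, IsFiniteMeasure (μn n ω)]
    (hμ : IsLittleOP P (fun n ω => ⨆ x : Fin k → ℝ, ‖distFun (μn n ω) x - distFun μ x‖ₑ))
    {B : Fin k → Set ℝ} (hB : ∀ i, (B i).OrdConnected) (hpos : 0 < μ (boxTrace U B))
    (hsub : boxTrace U B ⊆ U₀) {c : ℝ} (hc : 0 < c) :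
    Tendsto (fun n => innerProb P {ω | ENNReal.ofReal c < D.intStat μn n ω}) atTop (𝓝 1) := by
  set b : ℝ := μ.real (boxTrace U B) with hb
  have hb0 : 0 < b := ENNReal.toReal_pos hpos.ne' (measure_ne_top _ _)
  have hδ : 0 < b / (2 * 2 ^ k) := by positivity
  refine tendsto_innerProb_one (tendsto_measure_zero_mono (tendsto_measure_union_zero
    (hμ.tendsto_not_forall_abs_le hδ)
    (D.tendsto_not_forall_le_ell h2 h1 h3 (c := 4 * c / b) (by positivity)))
    (Eventually.of_forall fun n ω hω => ?_))
  by_contra hcon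
  simp only [Set.mem_union, Set.mem_ofPred_eq, not_or, not_not] at hcon
  obtain ⟨hdist, hell⟩ := hcon
  refine hω ?_
  -- `μn` gives the box at least half of its `μ`-measure `b`
  have hbox : b / 2 ≤ (μn n ω).real (boxTrace U B) := by
    have := (abs_le.1 (abs_measureReal_box_sub_le hdist hB)).1
    have e : 2 ^ k * (b / (2 * 2 ^ k)) = b / 2 := by field_simp
    rw [e] at this
    linarith
  calc ENNReal.ofReal c < ENNReal.ofReal (4 * c / b * (b / 2)) := by
        rw [ENNReal.ofReal_lt_ofReal_iff (by positivity)]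
        have : 4 * c / b * (b / 2) = 2 * c := by field_simp; norm_num
        linarith
    _ ≤ ENNReal.ofReal (4 * c / b) * (μn n ω) (boxTrace U B) := by
        rw [ENNReal.ofReal_mul (by positivity), ← ofReal_measureReal (μ := μn n ω)]
        gcongr
    _ = ∫⁻ _ in boxTrace U B, ENNReal.ofReal (4 * c / b) ∂(μn n ω) := by rw [setLIntegral_const]
    _ ≤ ∫⁻ u in boxTrace U B, D.ell n ω u ∂(μn n ω) :=
        setLIntegral_mono' (measurableSet_boxTrace hB) fun u hu => hell u (hsub hu)
    _ ≤ D.intStat μn n ω := setLIntegral_le_lintegral _ _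

end Alternative

end TestSetup

theorem theorem2p1
    {Ω S : Type*} [MeasurableSpace Ω] (P : Measure Ω) [IsProbabilityMeasure P]
    {d p k : ℕ} (U : Set (Fin k → ℝ)) (hU : IsCompact U)
    (Θ : Set (Fin p → ℝ)) (hΘ : IsCompact Θ) (G : Set (S → ℝ))
    (D : TestSetup Ω S d p U) (hD : D.IsSample P)
    -- the measures in the integral statistic
    (μ : Measure U) [IsFiniteMeasure μ]
    (μn : ℕ → Ω → Measure U) [∀ n ω, IsFiniteMeasure (μn n ω)]
    (hμ : IsLittleOP P (fun n ω => ⨆ x : Fin k → ℝ, ‖distFun (μn n ω) x - distFun μ x‖ₑ)) :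
    -- (a) under the null hypothesis
    (∀ (θ₀ : Fin p → ℝ) (g₀ : S → ℝ)
        (Q : (Fin d → ℝ) → ℝ → U → (Fin p → ℝ) → (S → ℝ) → ℝ) (T : U → ℝ)
        {Ω' : Type*} [MeasurableSpace Ω'] (P' : Measure Ω') [IsProbabilityMeasure P']
        (V : Ω' → U → ℝ),
      D.IsTrue P Θ G θ₀ g₀ → D.C0 P → D.C1 P P' Q θ₀ g₀ V → D.C2 P T → D.C3 P →
      WeakConvLinf P P' (fun n ω u => (D.ell n ω u : EReal))
        (fun ω' u => (V ω' u / √(T u)) ^ 2) ∧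
      WeakConv P P' D.supStat (fun ω' => ⨆ u, ENNReal.ofReal ((V ω' u / √(T u)) ^ 2)) ∧
      ((∀ᵐ ω' ∂P', IsBoxRiemann μ (fun u => (V ω' u / √(T u)) ^ 2)) →
        WeakConv P P' (D.intStat μn)
          (fun ω' => ∫⁻ u, ENNReal.ofReal ((V ω' u / √(T u)) ^ 2) ∂μ))) ∧
    -- (b) under a fixed alternative
    (∀ (T : U → ℝ) (U₀ : Set U),
      ¬ D.H0 P Θ G → D.C2 P T → 0 < μ U₀ → D.C1' P U₀ → D.C3' P →
      (∀ c : ℝ, 0 < c →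
        Tendsto (fun n => innerProb P {ω | ENNReal.ofReal c < D.supStat n ω}) atTop (𝓝 1)) ∧
      ((∃ a b : Fin k → ℝ, 0 < μ (boxTrace U (fun i => Set.Icc (a i) (b i))) ∧
          boxTrace U (fun i => Set.Icc (a i) (b i)) ⊆ U₀) →
        ∀ c : ℝ, 0 < c →
          Tendsto (fun n => innerProb P {ω | ENNReal.ofReal c < D.intStat μn n ω})
            atTop (𝓝 1))) := by
  refine ⟨?_, ?_⟩
  · intro θ₀ g₀ Q T Ω' _ P' _ V _ _ h1 h2 h3
    exact ⟨D.weakConvLinf_ell h1.weakConv h2 h3, D.weakConv_supStat h1.weakConv h2 h3,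
      D.weakConv_intStat h1.weakConv h2 h3 hμ⟩
  · intro T U₀ _ h2 hU₀ h1 h3
    refine ⟨fun c hc => D.tendsto_innerProb_supStat h2 h1 h3
      (nonempty_of_measure_ne_zero hU₀.ne') hc, ?_⟩
    rintro ⟨a, b, hpos, hsub⟩ c hc
    exact D.tendsto_innerProb_intStat h2 h1 h3 hμ (fun i => Set.ordConnected_Icc) hpos hsub hc
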